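/- All graphs are finite, undirected and simple. For a graph $G$ with $n\ge 1$ vertices and $m$ edges, let $\sigma(G)$ be the number of eigenvalues, counted with multiplicity, of the Laplacian matrix $L(G)=D(G)-A(G)$ that are greater than or equal to the average degree $\frac{2m}{n}$ of $G$. Here $D(G)$ is the diagonal matrix of vertex degrees and $A(G)$ is the adjacency matrix. A graph is pseudo-split if it has no induced subgraph isomorphic to $2K_2$ or $C_4$. A graph is extended $P_4$-laden if every induced subgraph on at most six vertices that contains more than two induced $P_4$'s (chordless paths on four vertices) is pseudo-split. Denote by $K_{1,r}+sK_1$ the star on $r+1$ vertices plus $s$ isolated vertices, and by $K_2+sK_1$ the disjoint union of an edge and $s$ isolated vertices. **Theorem.** Let $G$ be an extended $P_4$-laden graph. Then $\sigma(G)=1$ if and only if $G$ is isomorphic to $K_1$, to $K_2+sK_1$ for some integer $s\ge 0$, or to $K_{1,r}+sK_1$ for some integers $r\ge 2$ and $0\le s<r-1$. -/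

import Mathlib

namespace SimpleGraph

/-- The average degree `2m/n` of a finite graph with `n` vertices and `m` edges. -/
noncomputable def averageDegree {V : Type*} [Fintype V] (G : SimpleGraph V) :
    ℝ :=
  2 * (Nat.card G.edgeSet : ℝ) / (Fintype.card V : ℝ)

/-- `σ(G)`: the number of Laplacian eigenvalues of `G`, counted with multiplicity, which are
greater than or equal to the average degree of `G`. -/
noncomputable def laplacianSigma {V : Type*} [Fintype V] [DecidableEq V] (G : SimpleGraph V)
    [DecidableRel G.Adj] : ℕ :=
  Fintype.card
    {i : V // G.averageDegree ≤ (G.isHermitian_lapMatrix (R := ℝ)).eigenvalues i}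

/-- The graph `2K₂`. -/
def twoK2 : SimpleGraph (Fin 2 ⊕ Fin 2) :=
  completeGraph (Fin 2) ⊕g completeGraph (Fin 2)

/-- A graph is pseudo-split if it has neither `2K₂` nor `C₄` as an induced subgraph. -/
def IsPseudoSplit {V : Type*} (G : SimpleGraph V) : Prop :=
  ¬ twoK2.IsIndContained G ∧ ¬ (cycleGraph 4).IsIndContained G

/-- The number of induced `P₄`'s (chordless paths on four vertices) of a finite graph: the number
of vertex sets inducing a graph isomorphic to `P₄`. -/
noncomputable def numInducedP4 {V : Type*} (G : SimpleGraph V) : ℕ :=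
  {X : Set V | Nonempty (G.induce X ≃g pathGraph 4)}.ncard

/-- A graph is extended `P₄`-laden if every induced subgraph on at most six vertices that contains
more than two induced `P₄`'s is pseudo-split. -/
def IsExtendedP4Laden {V : Type*} (G : SimpleGraph V) : Prop :=
  ∀ W : Finset V, W.card ≤ 6 → 2 < numInducedP4 (G.induce (W : Set V)) →
    IsPseudoSplit (G.induce (W : Set V))

/-- The graph `K_{1,r} + sK₁`: the star on `r + 1` vertices plus `s` isolated vertices. -/
def starAddIsolated (r s : ℕ) : SimpleGraph ((Fin 1 ⊕ Fin r) ⊕ Fin s) :=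
  completeBipartiteGraph (Fin 1) (Fin r) ⊕g (⊥ : SimpleGraph (Fin s))

/-- The graph `K₂ + sK₁`: one edge plus `s` isolated vertices. -/
def K2AddIsolated (s : ℕ) : SimpleGraph (Fin 2 ⊕ Fin s) :=
  completeGraph (Fin 2) ⊕g (⊥ : SimpleGraph (Fin s))

end SimpleGraph

/-!
Write `a` for the average degree. Since the trace of the Laplacian is `n * a`, some eigenvalue is at
least `a`, so `σ(G) = 1` says that no plane exists on which the Laplacian form is at least `a` times
the squared norm (`two_le_laplacianSigma_iff`, with `HasTwoAbove` for the existence of such a plane).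

Such planes are found by hand in four situations: around two vertices of degree at least `a`, if
`a > 2` (`hasTwoAbove_of_degree`); on a triangle whose vertices have degree at least `a - 1`
(`hasTwoAbove_of_triangle`); on an induced path with four vertices, if `a ≤ 2`
(`hasTwoAbove_two_of_path`); and in a join, where the number of vertices is an eigenvalue
(`starLike_or_hasTwoAbove_of_join`).

With these, every extended `P₄`-laden graph either has all its edges at one vertex or has two
eigenvalues that are at least `a` (`IsLaden.starLike_or_hasTwoAbove`), by induction. In a
disconnected graph, one of the two parts has average degree at least `a`, and a plane found there
serves for the whole graph. A graph with disconnected complement is a join. In the remaining case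
the maximal proper modules form a prime quotient. If that quotient contains a `C₄`, a `2K₂` or a
`C₅`, the graph is a house, the complement of a house or a `C₅`; otherwise the quotient is split, and
the graph is a spider in which the vertices of the body and the legs may be doubled
(`IsLaden.exists_spiderPartition_or`). In a spider there are at least five vertices of degree at least
`a - 1` if at most one vertex has degree at least `a` (`four_lt_card_of_not_hasTwoAbove`); they cannot
all avoid forming a triangle (`IsSpiderPartition.hasTwoAbove_averageDegree`).

For a graph with all edges at one vertex, with `r` edges on `n` vertices, the quadratic form is
explicit. Two large eigenvalues are excluded exactly if `n = 1`, `r = 1` or `2 ≤ r` and `n < 2 * r`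
(`not_hasTwoAbove_averageDegree_iff_of_star`), which gives the three families.
-/

namespace SimpleGraph

/-! ### The Laplacian form and the number of large eigenvalues -/

section LaplacianForm

theorem averageDegree_mul_card {V : Type*} [Fintype V] (G : SimpleGraph V)
    [DecidableRel G.Adj] :
    G.averageDegree * Fintype.card V = ∑ v, (G.degree v : ℝ) := by
  rcases isEmpty_or_nonempty V with hV | hV
  · simp
  · have : (Fintype.card V : ℝ) ≠ 0 := by exact_mod_cast Fintype.card_ne_zero
    rw [averageDegree, div_mul_cancel₀ _ this]
    have h := G.sum_degrees_eq_twice_card_edges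
    rw [Nat.card_eq_fintype_card, ← edgeFinset_card]
    exact_mod_cast h.symm

theorem exists_averageDegree_le_degree {V : Type*} [Fintype V] [Nonempty V] (G : SimpleGraph V)
    [DecidableRel G.Adj] : ∃ v, G.averageDegree ≤ G.degree v := by
  by_contra! h
  have h1 : ∑ v, (G.degree v : ℝ) < ∑ _v : V, G.averageDegree :=
    Finset.sum_lt_sum_of_nonempty Finset.univ_nonempty fun v _ => h v
  rw [← averageDegree_mul_card] at h1
  simp [mul_comm] at h1

theorem dotProduct_self_nonneg' {V : Type*} [Fintype V] (x : V → ℝ) : 0 ≤ x ⬝ᵥ x :=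
  Finset.sum_nonneg fun i _ => mul_self_nonneg (x i)

theorem dotProduct_self_pos' {V : Type*} [Fintype V] {x : V → ℝ} (hx : x ≠ 0) : 0 < x ⬝ᵥ x :=
  lt_of_le_of_ne (dotProduct_self_nonneg' x) fun h => hx (dotProduct_self_eq_zero.1 h.symm)

variable {V : Type*} [Fintype V] [DecidableEq V] (G : SimpleGraph V) [DecidableRel G.Adj]

/-- The bilinear form `(x, y) ↦ xᵀ L(G) y` of the Laplacian matrix. -/
noncomputable def lapForm : (V → ℝ) →ₗ[ℝ] (V → ℝ) →ₗ[ℝ] ℝ :=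
  Matrix.toLinearMap₂' ℝ (G.lapMatrix ℝ)

theorem lapForm_apply (x y : V → ℝ) : G.lapForm x y = x ⬝ᵥ (G.lapMatrix ℝ).mulVec y :=
  Matrix.toLinearMap₂'_apply' _ _ _

theorem lapForm_comm (x y : V → ℝ) : G.lapForm x y = G.lapForm y x := by
  rw [lapForm_apply, lapForm_apply, Matrix.dotProduct_mulVec, ← Matrix.mulVec_transpose,
    (G.isSymm_lapMatrix ℝ).eq, dotProduct_comm]

theorem lapForm_self (x : V → ℝ) :
    G.lapForm x x = (∑ i, ∑ j, if G.Adj i j then (x i - x j) ^ 2 else 0) / 2 :=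
  G.lapMatrix_toLinearMap₂' ℝ x

theorem lapForm_single_self (u : V) :
    G.lapForm (Pi.single u 1) (Pi.single u 1) = G.degree u := by
  rw [lapForm_apply, single_one_dotProduct, Matrix.mulVec_single_one]
  simp [lapMatrix, degMatrix]

theorem lapForm_single_of_ne {u v : V} (h : u ≠ v) :
    G.lapForm (Pi.single u 1) (Pi.single v 1) = if G.Adj u v then -1 else 0 := by
  rw [lapForm_apply, single_one_dotProduct, Matrix.mulVec_single_one]
  simp only [lapMatrix, degMatrix, Matrix.col_apply, Matrix.sub_apply, Matrix.diagonal_apply_ne _ h,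
    adjMatrix_apply]
  split_ifs <;> simp

/-- The edges at two adjacent vertices contribute to the Laplacian form; the edge joining them
is counted in both sums. -/
theorem sum_adj_pair_le_lapForm {u v : V} (h : G.Adj u v) (x : V → ℝ) :
    ∑ w, ((if G.Adj u w then (x u - x w) ^ 2 else 0) +
      (if G.Adj v w then (x v - x w) ^ 2 else 0)) - (x u - x v) ^ 2 ≤ G.lapForm x x := by
  set F : V → V → ℝ := fun i j => if G.Adj i j then (x i - x j) ^ 2 else 0 with hF
  have h0 : ∀ i j, 0 ≤ F i j := fun i j => by simp only [hF]; split_ifs <;> positivity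
  have hs : ∀ i j, F i j = F j i := fun i j => by
    simp only [hF, G.adj_comm i j]; split_ifs <;> ring
  have hself : ∀ i, F i i = 0 := fun i => by simp [hF]
  have huv : F u v = (x u - x v) ^ 2 := by simp [hF, h]
  have hne : u ≠ v := h.ne
  have key : ∀ i, (if i = u then ∑ j, F u j else 0) + (if i = v then ∑ j, F v j else 0)
      + F u i + F v i - (if i = u then F u v else 0) - (if i = v then F u v else 0)
      ≤ ∑ j, F i j := by
    intro i
    by_cases hu : i = u
    · subst hu; simp [hne, hself, hs v i]
    · by_cases hv : i = v
      · subst hv; simp [hu, hself]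
      · simp only [hu, hv, if_false]
        have : F i u + F i v ≤ ∑ j, F i j := by
          rw [← Finset.sum_pair hne]
          exact Finset.sum_le_sum_of_subset_of_nonneg (Finset.subset_univ _) fun j _ _ => h0 i j
        rw [hs u i, hs v i]; linarith
  have := Finset.sum_le_sum fun i (_ : i ∈ Finset.univ) => key i
  simp only [Finset.sum_sub_distrib, Finset.sum_add_distrib, Finset.sum_ite_eq', Finset.mem_univ,
    if_true] at this
  rw [lapForm_self, Finset.sum_add_distrib]
  change _ ≤ (∑ i, ∑ j, F i j) / 2
  change ∑ j, F u j + ∑ j, F v j - _ ≤ _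
  linarith

/-- The Laplacian form of `G` is at least `a` times the squared Euclidean norm on some plane.
By the min-max principle this says that at least two Laplacian eigenvalues are `≥ a`. -/
def HasTwoAbove (a : ℝ) : Prop :=
  ∃ x y : V → ℝ, LinearIndependent ℝ ![x, y] ∧
    ∀ α β : ℝ, a * ((α • x + β • y) ⬝ᵥ (α • x + β • y)) ≤
      G.lapForm (α • x + β • y) (α • x + β • y)

variable {G}

theorem HasTwoAbove.mono {a b : ℝ} (h : G.HasTwoAbove a) (hab : b ≤ a) : G.HasTwoAbove b := by
  obtain ⟨x, y, hxy, H⟩ := h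
  exact ⟨x, y, hxy, fun α β =>
    (mul_le_mul_of_nonneg_right hab (dotProduct_self_nonneg' _)).trans (H α β)⟩

theorem hasTwoAbove_of_orthogonal {a : ℝ} {x y : V → ℝ} (hx : x ≠ 0) (hy : y ≠ 0)
    (hxy : x ⬝ᵥ y = 0) (hL : G.lapForm x y = 0) (hxa : a * (x ⬝ᵥ x) ≤ G.lapForm x x)
    (hya : a * (y ⬝ᵥ y) ≤ G.lapForm y y) : G.HasTwoAbove a := by
  have hyx : y ⬝ᵥ x = 0 := by rw [dotProduct_comm, hxy]
  have hL' : G.lapForm y x = 0 := by rw [lapForm_comm, hL]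
  have key : ∀ α β : ℝ, (α • x + β • y) ⬝ᵥ (α • x + β • y)
      = α ^ 2 * (x ⬝ᵥ x) + β ^ 2 * (y ⬝ᵥ y) := fun α β => by
    simp only [add_dotProduct, dotProduct_add, smul_dotProduct, dotProduct_smul, hxy, hyx,
      smul_eq_mul]
    ring
  refine ⟨x, y, LinearIndependent.pair_iff.2 fun α β h => ?_, fun α β => ?_⟩
  · have h1 := key α β
    rw [h] at h1
    have hx' := dotProduct_self_pos' hx
    have hy' := dotProduct_self_pos' hy
    simp only [dotProduct_zero] at h1
    have hx2 := mul_nonneg (sq_nonneg α) hx'.le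
    have hy2 := mul_nonneg (sq_nonneg β) hy'.le
    have hα : α ^ 2 * (x ⬝ᵥ x) = 0 := by linarith
    have hβ : β ^ 2 * (y ⬝ᵥ y) = 0 := by linarith
    exact ⟨by simpa [hx'.ne'] using hα, by simpa [hy'.ne'] using hβ⟩
  · rw [key]
    simp only [map_add, map_smul, LinearMap.add_apply, LinearMap.smul_apply, hL, hL', smul_eq_mul]
    nlinarith [mul_le_mul_of_nonneg_left hxa (sq_nonneg α),
      mul_le_mul_of_nonneg_left hya (sq_nonneg β)]

/-- A plane meets every hyperplane in a nonzero vector. -/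
theorem HasTwoAbove.exists_ker {a : ℝ} (h : G.HasTwoAbove a) (l : (V → ℝ) →ₗ[ℝ] ℝ) :
    ∃ z, z ≠ 0 ∧ l z = 0 ∧ a * (z ⬝ᵥ z) ≤ G.lapForm z z := by
  obtain ⟨x, y, hxy, H⟩ := h
  rw [LinearIndependent.pair_iff] at hxy
  by_cases hx : l x = 0
  · refine ⟨(1 : ℝ) • x + (0 : ℝ) • y, fun h => ?_, by simp [hx], H _ _⟩
    exact one_ne_zero (hxy _ _ h).1
  · refine ⟨(l y) • x + (-l x) • y, fun h => ?_, ?_, H _ _⟩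
    · exact hx (neg_eq_zero.1 (hxy _ _ h).2)
    · simp [mul_comm]

section Eigenvalues

variable (G)

/-- Coordinates in an orthonormal eigenbasis diagonalize the Laplacian form. -/
theorem exists_diagonalization : ∃ c : V → (V → ℝ) →ₗ[ℝ] ℝ,
    (∀ x, x ⬝ᵥ x = ∑ i, c i x ^ 2) ∧
    ∀ x, G.lapForm x x =
      ∑ i, (G.isHermitian_lapMatrix (R := ℝ)).eigenvalues i * c i x ^ 2 := by
  set hA := G.isHermitian_lapMatrix (R := ℝ)
  set b := hA.eigenvectorBasis
  have hdot : ∀ x y : V → ℝ, x ⬝ᵥ y = ∑ i, ((b i).ofLp ⬝ᵥ x) * ((b i).ofLp ⬝ᵥ y) := by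
    intro x y
    have := b.sum_inner_mul_inner (WithLp.toLp 2 x) (WithLp.toLp 2 y)
    simp only [EuclideanSpace.inner_eq_star_dotProduct, star_trivial] at this
    rw [dotProduct_comm, ← this]
    exact Finset.sum_congr rfl fun i _ => by rw [dotProduct_comm y]
  refine ⟨fun i => dotProductBilin ℝ ℝ (b i).ofLp, fun x => ?_, fun x => ?_⟩
  · rw [hdot]
    exact Finset.sum_congr rfl fun i _ => by rw [sq]; rfl
  · rw [lapForm_apply, hdot]
    refine Finset.sum_congr rfl fun i _ => ?_
    have : (b i).ofLp ⬝ᵥ (G.lapMatrix ℝ).mulVec x = hA.eigenvalues i * ((b i).ofLp ⬝ᵥ x) := by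
      rw [← lapForm_apply, lapForm_comm, lapForm_apply, hA.mulVec_eigenvectorBasis,
        dotProduct_smul, smul_eq_mul, dotProduct_comm x]
    rw [this]
    change _ = _ * ((b i).ofLp ⬝ᵥ x) ^ 2
    ring

/-- One direction takes the plane of two eigenvectors. Conversely, if at most one eigenvalue is large,
the plane contains a nonzero vector whose coordinate at that eigenvalue vanishes. -/
theorem two_le_laplacianSigma_iff : 2 ≤ G.laplacianSigma ↔ G.HasTwoAbove G.averageDegree := by
  set hA := G.isHermitian_lapMatrix (R := ℝ) with hA'
  constructor
  · intro h
    obtain ⟨⟨i, hi⟩, ⟨j, hj⟩, hij⟩ := Fintype.one_lt_card_iff.1 h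
    have hij : i ≠ j := fun h => hij (Subtype.ext h)
    set b := hA.eigenvectorBasis
    have hdot : ∀ k l, (b k).ofLp ⬝ᵥ (b l).ofLp = if k = l then 1 else 0 := by
      intro k l
      have := b.inner_eq_ite k l
      rw [EuclideanSpace.inner_eq_star_dotProduct, star_trivial, dotProduct_comm] at this
      exact this
    have hform : ∀ k l, G.lapForm (b k).ofLp (b l).ofLp
        = hA.eigenvalues l * if k = l then 1 else 0 := by
      intro k l
      rw [lapForm_apply, hA.mulVec_eigenvectorBasis, dotProduct_smul, hdot, smul_eq_mul]
    refine hasTwoAbove_of_orthogonal (x := (b i).ofLp) (y := (b j).ofLp) ?_ ?_ ?_ ?_ ?_ ?_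
    · intro h0; have := hdot i i; simp [h0] at this
    · intro h0; have := hdot j j; simp [h0] at this
    · simp [hdot, hij]
    · simp [hform, hij]
    · simpa [hform, hdot] using hi
    · simpa [hform, hdot] using hj
  · intro h
    by_contra hlt
    have hle : Fintype.card {i : V // G.averageDegree ≤ hA.eigenvalues i} ≤ 1 := by
      have : G.laplacianSigma < 2 := not_le.1 hlt
      unfold laplacianSigma at this
      omega
    have hsub := Fintype.card_le_one_iff.1 hle
    obtain ⟨c, hc1, hc2⟩ := G.exists_diagonalization
    obtain ⟨l, hl⟩ : ∃ l : (V → ℝ) →ₗ[ℝ] ℝ, ∀ z, l z = 0 → ∀ i,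
        G.averageDegree ≤ hA.eigenvalues i → c i z = 0 := by
      by_cases hex : ∃ i, G.averageDegree ≤ hA.eigenvalues i
      · obtain ⟨i, hi⟩ := hex
        refine ⟨c i, fun z hz j hj => ?_⟩
        have := congrArg Subtype.val (hsub ⟨i, hi⟩ ⟨j, hj⟩)
        simp only at this
        rwa [← this]
      · exact ⟨0, fun z _ i hi => absurd ⟨i, hi⟩ hex⟩
    obtain ⟨z, hz, hlz, hz'⟩ := h.exists_ker l
    rw [hc1, hc2, Finset.mul_sum] at hz'
    refine absurd hz' (not_le.2 (Finset.sum_lt_sum (fun i _ => ?_) ?_))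
    · by_cases hi : G.averageDegree ≤ hA.eigenvalues i
      · simp [hl z hlz i hi]
      · exact mul_le_mul_of_nonneg_right (not_le.1 hi).le (sq_nonneg _)
    · have hpos := dotProduct_self_pos' hz
      rw [hc1] at hpos
      obtain ⟨i, -, hi⟩ := Finset.exists_lt_of_sum_lt
        (show ∑ i : V, (0 : ℝ) < ∑ i, c i z ^ 2 by simpa using hpos)
      refine ⟨i, Finset.mem_univ _, ?_⟩
      have hi' : ¬ G.averageDegree ≤ hA.eigenvalues i := fun h => by
        simp [hl z hlz i h] at hi
      exact mul_lt_mul_of_pos_right (not_le.1 hi') hi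

/-- The indicator vector of a vertex has its degree as Rayleigh quotient. -/
theorem one_le_laplacianSigma [Nonempty V] : 1 ≤ G.laplacianSigma := by
  obtain ⟨v, hv⟩ := G.exists_averageDegree_le_degree
  by_contra hlt
  have hempty : IsEmpty {i : V // G.averageDegree ≤
      (G.isHermitian_lapMatrix (R := ℝ)).eigenvalues i} := by
    rw [← Fintype.card_eq_zero_iff]
    unfold laplacianSigma at hlt
    omega
  obtain ⟨c, hc1, hc2⟩ := G.exists_diagonalization
  have h1 := hc1 (Pi.single v 1)
  have h2 := hc2 (Pi.single v 1)
  rw [lapForm_single_self] at h2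
  simp only [single_one_dotProduct, Pi.single_eq_same] at h1
  have h3 : ∑ i, (G.isHermitian_lapMatrix (R := ℝ)).eigenvalues i * c i (Pi.single v 1) ^ 2 <
      ∑ i, G.averageDegree * c i (Pi.single v 1) ^ 2 := by
    refine Finset.sum_lt_sum (fun i _ => ?_) ?_
    · exact mul_le_mul_of_nonneg_right (not_le.1 fun h => hempty.false ⟨i, h⟩).le (sq_nonneg _)
    · obtain ⟨i, -, hi⟩ := Finset.exists_lt_of_sum_lt
        (show ∑ i : V, (0 : ℝ) < ∑ i, c i (Pi.single v 1) ^ 2 by rw [← h1]; simp)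
      exact ⟨i, Finset.mem_univ _,
        mul_lt_mul_of_pos_right (not_le.1 fun h => hempty.false ⟨i, h⟩) hi⟩
  rw [← Finset.mul_sum, ← h1, ← h2] at h3
  linarith

end Eigenvalues

end LaplacianForm

/-! ### Two large eigenvalues from vertices, triangles and paths -/

section Criteria

variable {V : Type*} [Fintype V] [DecidableEq V] {G : SimpleGraph V} [DecidableRel G.Adj] {a : ℝ}

theorem hasTwoAbove_of_not_adj {u v : V} (huv : u ≠ v) (h : ¬ G.Adj u v)
    (hu : a ≤ G.degree u) (hv : a ≤ G.degree v) : G.HasTwoAbove a :=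
  hasTwoAbove_of_orthogonal (x := Pi.single u 1) (y := Pi.single v 1) (by simp) (by simp)
    (by simp [huv]) (by simp [lapForm_single_of_ne _ huv, h])
    (by simpa [lapForm_single_self] using hu) (by simpa [lapForm_single_self] using hv)

/-- The vectors supported on a triangle with coordinate sum zero form the required plane. -/
theorem hasTwoAbove_of_triangle {u v w : V} (huv : G.Adj u v) (huw : G.Adj u w)
    (hvw : G.Adj v w) (hu : a ≤ G.degree u + 1) (hv : a ≤ G.degree v + 1)
    (hw : a ≤ G.degree w + 1) : G.HasTwoAbove a := by
  have e1 := huv.ne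
  have e2 := huw.ne
  have e3 := hvw.ne
  refine ⟨Pi.single u 1 - Pi.single w 1, Pi.single v 1 - Pi.single w 1,
    LinearIndependent.pair_iff.2 fun s t h => ?_, fun α β => ?_⟩
  · have h1 := congrFun h u
    have h2 := congrFun h v
    simp [e1, e2, e3, e1.symm] at h1 h2
    exact ⟨h1, h2⟩
  · simp only [map_add, map_sub, map_smul, LinearMap.add_apply, LinearMap.sub_apply,
      LinearMap.smul_apply, lapForm_single_self, lapForm_single_of_ne _ e1,
      lapForm_single_of_ne _ e2, lapForm_single_of_ne _ e3, lapForm_single_of_ne _ e1.symm,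
      lapForm_single_of_ne _ e2.symm, lapForm_single_of_ne _ e3.symm, huv, huw, hvw, huv.symm,
      huw.symm, hvw.symm, if_true, add_dotProduct, dotProduct_add, sub_dotProduct, dotProduct_sub,
      smul_dotProduct, dotProduct_smul, single_one_dotProduct, Pi.single_eq_same,
      Pi.single_eq_of_ne e1, Pi.single_eq_of_ne e2, Pi.single_eq_of_ne e3,
      Pi.single_eq_of_ne e1.symm, Pi.single_eq_of_ne e2.symm, Pi.single_eq_of_ne e3.symm,
      smul_eq_mul]
    nlinarith [mul_nonneg (sub_nonneg.2 hu) (sq_nonneg α),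
      mul_nonneg (sub_nonneg.2 hv) (sq_nonneg β),
      mul_nonneg (sub_nonneg.2 hw) (sq_nonneg (α + β))]

/-- On an induced path `p - q - r - s` the vectors `(1, -1, -1, 1)` and `(0, 1, -1, 0)` are
orthogonal, also for the Laplacian form of the path, and have Rayleigh quotients `2` and `3`. -/
theorem hasTwoAbove_two_of_path {p q r s : V} (hpq : G.Adj p q) (hqr : G.Adj q r)
    (hrs : G.Adj r s) (hpr : ¬ G.Adj p r) (hqs : ¬ G.Adj q s) (hps : ¬ G.Adj p s) :
    G.HasTwoAbove 2 := by
  have n1 := hpq.ne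
  have n2 := hqr.ne
  have n3 := hrs.ne
  have n4 : p ≠ r := by rintro rfl; exact hps hrs
  have n5 : q ≠ s := by rintro rfl; exact hps hpq
  have n6 : p ≠ s := by rintro rfl; exact hqs hpq.symm
  have hpr' : ¬ G.Adj r p := fun h => hpr h.symm
  have hqs' : ¬ G.Adj s q := fun h => hqs h.symm
  have hps' : ¬ G.Adj s p := fun h => hps h.symm
  have d1 : (1 : ℝ) ≤ G.degree p := by
    exact_mod_cast (G.degree_pos_iff_exists_adj p).2 ⟨q, hpq⟩
  have d4 : (1 : ℝ) ≤ G.degree s := by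
    exact_mod_cast (G.degree_pos_iff_exists_adj s).2 ⟨r, hrs.symm⟩
  have two : ∀ {v x y : V}, G.Adj v x → G.Adj v y → x ≠ y → (2 : ℝ) ≤ G.degree v := by
    intro v x y hx hy hxy
    have : 1 < (G.neighborFinset v).card := Finset.one_lt_card.2 ⟨x, by simpa, y, by simpa, hxy⟩
    rw [card_neighborFinset_eq_degree] at this
    exact_mod_cast this
  have d2 := two hpq.symm hqr n4
  have d3 := two hqr.symm hrs n5
  refine ⟨Pi.single p 1 - Pi.single q 1 - Pi.single r 1 + Pi.single s 1,
    Pi.single q 1 - Pi.single r 1, LinearIndependent.pair_iff.2 fun α β h => ?_, fun α β => ?_⟩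
  · have h1 := congrFun h p
    have h2 := congrFun h q
    simp [n1, n4, n6, n1.symm, n2, n5] at h1 h2
    subst h1
    simpa using h2
  · simp only [map_add, map_sub, map_smul, LinearMap.add_apply, LinearMap.sub_apply,
      LinearMap.smul_apply, lapForm_single_self, lapForm_single_of_ne _ n1,
      lapForm_single_of_ne _ n2, lapForm_single_of_ne _ n3, lapForm_single_of_ne _ n1.symm,
      lapForm_single_of_ne _ n2.symm, lapForm_single_of_ne _ n3.symm, lapForm_single_of_ne _ n4,
      lapForm_single_of_ne _ n5, lapForm_single_of_ne _ n6, lapForm_single_of_ne _ n4.symm,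
      lapForm_single_of_ne _ n5.symm, lapForm_single_of_ne _ n6.symm, hpq, hqr, hrs, hpq.symm,
      hqr.symm, hrs.symm, hpr, hqs, hps, hpr', hqs', hps', if_true, if_false, add_dotProduct,
      dotProduct_add, sub_dotProduct, dotProduct_sub,
      smul_dotProduct, dotProduct_smul, single_one_dotProduct, Pi.single_eq_same,
      Pi.single_eq_of_ne n1, Pi.single_eq_of_ne n2, Pi.single_eq_of_ne n3,
      Pi.single_eq_of_ne n1.symm, Pi.single_eq_of_ne n2.symm, Pi.single_eq_of_ne n3.symm,
      Pi.single_eq_of_ne n4, Pi.single_eq_of_ne n5, Pi.single_eq_of_ne n6,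
      Pi.single_eq_of_ne n4.symm, Pi.single_eq_of_ne n5.symm, Pi.single_eq_of_ne n6.symm,
      smul_eq_mul]
    nlinarith [mul_nonneg (sub_nonneg.2 d1) (sq_nonneg α),
      mul_nonneg (sub_nonneg.2 d4) (sq_nonneg α),
      mul_nonneg (sub_nonneg.2 d2) (sq_nonneg (α - β)),
      mul_nonneg (sub_nonneg.2 d3) (sq_nonneg (α + β)), sq_nonneg β]

/-- The maximum over `z` of `p (α - z)² + q (β - z)² - a z²`, for `p, q ∈ {0, 1}`. -/
theorem vertex_contribution {a p q : ℝ} (α β : ℝ) (ha : 2 < a) (hp : p = 0 ∨ p = 1)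
    (hq : q = 0 ∨ q = 1) :
    p * (α - -(p * α + q * β) / (a - p - q)) ^ 2 + q * (β - -(p * α + q * β) / (a - p - q)) ^ 2
      - a * (-(p * α + q * β) / (a - p - q) * (-(p * α + q * β) / (a - p - q))) =
    p * (a / (a - 1) * α ^ 2) + q * (a / (a - 1) * β ^ 2)
      + p * q * ((α + β) ^ 2 / (a - 2) - (α ^ 2 + β ^ 2) / (a - 1)) := by
  have ha1 : a - 1 ≠ 0 := by linarith
  have ha2 : a - 2 ≠ 0 := by linarith
  rcases hp with rfl | rfl <;> rcases hq with rfl | rfl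
  · simp
  · simp only [sub_zero]; field_simp; ring
  · simp only [sub_zero]; field_simp; ring
  · have e3 : a - 1 - 1 = a - 2 := by ring
    simp only [e3]; field_simp; ring

/-- The estimate behind `hasTwoAbove_of_adj`: `d` and `e` are the degrees of two adjacent vertices
and `c` is the number of their common neighbours. -/
theorem degree_bound {a c d e : ℝ} (α β : ℝ) (ha : 2 < a) (hc0 : 0 ≤ c) (hcu : c ≤ d - 1)
    (hcv : c ≤ e - 1) (hd : a ≤ d) (he : a ≤ e) :
    0 ≤ (d - 1) * (a / (a - 1) * α ^ 2) + (e - 1) * (a / (a - 1) * β ^ 2)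
      + c * ((α + β) ^ 2 / (a - 2) - (α ^ 2 + β ^ 2) / (a - 1))
      + (α - β) ^ 2 - a * α ^ 2 - a * β ^ 2 := by
  have ha1 : a - 1 ≠ 0 := by linarith
  have ha2 : a - 2 ≠ 0 := by linarith
  set r := a / (a - 1) with hr
  set κ := (α + β) ^ 2 / (a - 2) - (α ^ 2 + β ^ 2) / (a - 1) with hκ
  have hr0 : 0 < r := div_pos (by linarith) (by linarith)
  have hra : (a - 1) * r = a := by rw [hr]; field_simp
  have h3 : 0 ≤ (α + β) ^ 2 / (a - 2) := div_nonneg (sq_nonneg _) (by linarith)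
  -- the case of `c = a - 1` common neighbours and no private ones
  have key : 0 ≤ (a - 1) * κ + (α - β) ^ 2 := by
    have h2 : (a - 1) * κ = (α + β) ^ 2 + (α + β) ^ 2 / (a - 2) - (α ^ 2 + β ^ 2) := by
      simp only [hκ]; field_simp; ring
    rw [h2]; nlinarith [sq_nonneg (α - β), sq_nonneg (α + β)]
  have hα := mul_nonneg hr0.le (sq_nonneg α)
  have hβ := mul_nonneg hr0.le (sq_nonneg β)
  rcases le_total c (a - 1) with hca | hca
  · have h1 := mul_le_mul_of_nonneg_right (show a - 1 ≤ d - 1 by linarith) hα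
    have h2 := mul_le_mul_of_nonneg_right (show a - 1 ≤ e - 1 by linarith) hβ
    rw [← mul_assoc, hra] at h1 h2
    rcases le_total 0 κ with hk | hk
    · linarith [mul_nonneg hc0 hk, sq_nonneg (α - β)]
    · linarith [mul_le_mul_of_nonpos_right hca hk]
  · have h1 := mul_le_mul_of_nonneg_right hcu hα
    have h2 := mul_le_mul_of_nonneg_right hcv hβ
    have h4 : r * α ^ 2 + r * β ^ 2 + κ = α ^ 2 + β ^ 2 + (α + β) ^ 2 / (a - 2) := by
      simp only [hr, hκ]; field_simp; ring
    have h5 := mul_le_mul_of_nonneg_right hca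
      (show 0 ≤ r * α ^ 2 + r * β ^ 2 + κ by rw [h4]; positivity)
    have h6 : (a - 1) * (r * α ^ 2 + r * β ^ 2 + κ) = a * α ^ 2 + a * β ^ 2 + (a - 1) * κ := by
      rw [mul_add, mul_add, ← mul_assoc, ← mul_assoc, hra]
    have h7 : c * (r * α ^ 2 + r * β ^ 2 + κ) = c * (r * α ^ 2) + c * (r * β ^ 2) + c * κ := by
      ring
    linarith

/-- Given the values `α`, `β` at two adjacent vertices `u`, `v`, the value `x w` at any other
vertex `w` is chosen to maximize the contribution of `w` and of the edges joining it to `u`, `v`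
to `xᵀ L x - a xᵀ x`. -/
theorem hasTwoAbove_of_adj {u v : V} (huv : G.Adj u v) (ha : 2 < a)
    (hu : a ≤ G.degree u) (hv : a ≤ G.degree v) : G.HasTwoAbove a := by
  have hne := huv.ne
  set p : V → ℝ := fun w => if G.Adj u w then 1 else 0 with hp
  set q : V → ℝ := fun w => if G.Adj v w then 1 else 0 with hq
  have hp01 : ∀ w, p w = 0 ∨ p w = 1 := fun w => by simp only [hp]; split_ifs <;> simp
  have hq01 : ∀ w, q w = 0 ∨ q w = 1 := fun w => by simp only [hq]; split_ifs <;> simp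
  set x : V → ℝ := fun w => if w = u then 1 else if w = v then 0 else - p w / (a - p w - q w)
    with hx
  set y : V → ℝ := fun w => if w = u then 0 else if w = v then 1 else - q w / (a - p w - q w)
    with hy
  refine ⟨x, y, LinearIndependent.pair_iff.2 fun s t h => ?_, fun α β => ?_⟩
  · have h1 := congrFun h u
    have h2 := congrFun h v
    simp [hx, hy, hne.symm] at h1 h2
    exact ⟨h1, h2⟩
  set z := α • x + β • y with hz
  have hzu : z u = α := by simp [hz, hx, hy]
  have hzv : z v = β := by simp [hz, hx, hy, hne.symm]
  have hzw : ∀ w, w ≠ u → w ≠ v → z w = - (p w * α + q w * β) / (a - p w - q w) := by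
    intro w h1 h2
    simp only [hz, hx, hy, h1, h2, if_false, Pi.add_apply, Pi.smul_apply, smul_eq_mul]
    ring
  have h1 := G.sum_adj_pair_le_lapForm huv z
  rw [hzu, hzv] at h1
  set r := a / (a - 1) with hr
  set κ := (α + β) ^ 2 / (a - 2) - (α ^ 2 + β ^ 2) / (a - 1) with hκ
  set g : V → ℝ := fun w => p w * (α - z w) ^ 2 + q w * (β - z w) ^ 2 - a * (z w * z w) with hg
  have hpu : p u = 0 := by simp [hp]
  have hpv : p v = 1 := by simp [hp, huv]
  have hqu : q u = 1 := by simp [hq, huv.symm]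
  have hqv : q v = 0 := by simp [hq]
  -- away from `u` and `v`, the contribution of `w` depends on its adjacencies only
  have hgT : ∀ w, g w = (p w * (r * α ^ 2) + q w * (r * β ^ 2) + p w * q w * κ)
      + (if w = u then (β - α) ^ 2 - a * α ^ 2 - r * β ^ 2 else 0)
      + (if w = v then (α - β) ^ 2 - a * β ^ 2 - r * α ^ 2 else 0) := by
    intro w
    by_cases hwu : w = u
    · rw [hwu]
      simp only [hg, hpu, hqu, hzu, hne, if_true, if_false]
      ring
    by_cases hwv : w = v
    · rw [hwv]
      simp only [hg, hpv, hqv, hzv, hne.symm, if_true, if_false]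
      ring
    simp only [hg, hwu, hwv, if_false, hzw w hwu hwv]
    rw [add_zero, add_zero]
    exact vertex_contribution α β ha (hp01 w) (hq01 w)
  have hpd : ∑ w, p w = G.degree u := by
    simp only [hp]; rw [← G.degree_eq_sum_if_adj]
  have hqd : ∑ w, q w = G.degree v := by
    simp only [hq]; rw [← G.degree_eq_sum_if_adj]
  set c := ∑ w, p w * q w with hc
  have hsum : ∑ w, g w = G.degree u * (r * α ^ 2) + G.degree v * (r * β ^ 2) + c * κ
      + ((β - α) ^ 2 - a * α ^ 2 - r * β ^ 2) + ((α - β) ^ 2 - a * β ^ 2 - r * α ^ 2) := by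
    rw [Finset.sum_congr rfl fun w _ => hgT w]
    simp only [Finset.sum_add_distrib, Finset.sum_ite_eq', Finset.mem_univ, if_true,
      ← Finset.sum_mul, hpd, hqd, hc]
  have hc0 : 0 ≤ c := Finset.sum_nonneg fun w _ => by
    rcases hp01 w with h | h <;> rcases hq01 w with h' | h' <;> simp [h, h']
  -- a common neighbour of `u` and `v` is a neighbour of `u` other than `v`, and vice versa
  have hcu : c ≤ G.degree u - 1 := by
    have : c ≤ ∑ w, (p w - if w = v then 1 else 0) := Finset.sum_le_sum fun w _ => by
      by_cases h : w = v
      · subst h; simp [hp, hq, huv]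
      · rcases hp01 w with h1 | h1 <;> rcases hq01 w with h' | h' <;> simp [h1, h', h]
    simpa [Finset.sum_sub_distrib, hpd] using this
  have hcv : c ≤ G.degree v - 1 := by
    have : c ≤ ∑ w, (q w - if w = u then 1 else 0) := Finset.sum_le_sum fun w _ => by
      by_cases h : w = u
      · subst h; simp [hp, hq, huv.symm]
      · rcases hp01 w with h1 | h1 <;> rcases hq01 w with h' | h' <;> simp [h1, h', h]
    simpa [Finset.sum_sub_distrib, hqd] using this
  have hg' : ∑ w, g w = ∑ w, ((if G.Adj u w then (α - z w) ^ 2 else 0) +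
      (if G.Adj v w then (β - z w) ^ 2 else 0)) - a * (z ⬝ᵥ z) := by
    simp only [hg, hp, hq, Finset.sum_sub_distrib, dotProduct, Finset.mul_sum, ite_mul, one_mul,
      zero_mul]
  suffices h : 0 ≤ ∑ w, g w - (α - β) ^ 2 by linarith
  rw [hsum]
  have := degree_bound α β ha hc0 hcu hcv (by linarith) (by linarith)
  linarith

/-- Some lower bound on `a` is needed: a single edge has two vertices of degree `1`, but its
eigenvalues are `2` and `0`. -/
theorem hasTwoAbove_of_degree {u v : V} (huv : u ≠ v) (ha : 2 < a)
    (hu : a ≤ G.degree u) (hv : a ≤ G.degree v) : G.HasTwoAbove a := by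
  by_cases h : G.Adj u v
  · exact hasTwoAbove_of_adj h ha hu hv
  · exact hasTwoAbove_of_not_adj huv h hu hv

end Criteria

/-! ### Induced subgraphs and star-like graphs -/

section Subgraphs

/-- All edges of the graph share a vertex, so the graph is a star plus isolated vertices. -/
def IsStarLike {V : Type*} (G : SimpleGraph V) : Prop :=
  ∃ c, ∀ u v, G.Adj u v → u = c ∨ v = c

variable {V : Type*} [Fintype V] [DecidableEq V] {G : SimpleGraph V} [DecidableRel G.Adj] {a : ℝ}

theorem HasTwoAbove.of_embedding {W : Type*} [Fintype W] [DecidableEq W] {H : SimpleGraph W}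
    [DecidableRel H.Adj] (f : H ↪g G) (h : H.HasTwoAbove a) : G.HasTwoAbove a := by
  obtain ⟨x, y, hxy, hle⟩ := h
  set E := Function.ExtendByZero.linearMap ℝ (f : W → V) with hE
  have hEf : ∀ z w, E z (f w) = z w := fun z w => f.injective.extend_apply _ _ _
  have hE0 : ∀ z v, v ∉ Set.range f → E z v = 0 := fun z v hv =>
    Function.extend_apply' _ _ _ fun ⟨w, hw⟩ => hv ⟨w, hw⟩
  refine ⟨E x, E y, LinearIndependent.pair_iff.2 fun s t hst => ?_, fun α β => ?_⟩
  · refine LinearIndependent.pair_iff.1 hxy s t (funext fun w => ?_)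
    rw [← map_smul, ← map_smul, ← map_add] at hst
    have := congrFun hst (f w)
    rwa [hEf] at this
  · rw [← map_smul, ← map_smul, ← map_add]
    set z := α • x + β • y
    have h1 : E z ⬝ᵥ E z = z ⬝ᵥ z := by
      simp only [dotProduct]
      rw [← Finset.sum_subset (Finset.subset_univ (Finset.univ.map f.toEmbedding))]
      · rw [Finset.sum_map]
        exact Finset.sum_congr rfl fun w _ => by
          rw [RelEmbedding.coe_toEmbedding, hEf]
      · intro v _ hv
        rw [hE0 z v fun ⟨w, hw⟩ => hv (Finset.mem_map.2 ⟨w, Finset.mem_univ _, hw⟩), zero_mul]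
    have h2 : H.lapForm z z ≤ G.lapForm (E z) (E z) := by
      rw [lapForm_self, lapForm_self]
      have h0 : ∀ i j, 0 ≤ (if G.Adj i j then (E z i - E z j) ^ 2 else 0) := fun i j => by
        split_ifs <;> positivity
      refine div_le_div_of_nonneg_right ?_ zero_le_two
      refine le_trans ?_ (Finset.sum_le_sum_of_subset_of_nonneg
        (Finset.subset_univ (Finset.univ.map f.toEmbedding))
        fun i _ _ => Finset.sum_nonneg fun j _ => h0 i j)
      rw [Finset.sum_map]
      refine Finset.sum_le_sum fun i _ => ?_
      refine le_trans ?_ (Finset.sum_le_sum_of_subset_of_nonneg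
        (Finset.subset_univ (Finset.univ.map f.toEmbedding)) fun j _ _ => h0 _ j)
      rw [Finset.sum_map]
      refine le_of_eq (Finset.sum_congr rfl fun j _ => ?_)
      simp only [RelEmbedding.coe_toEmbedding, hEf, f.map_adj_iff]
    rw [h1]
    exact (hle α β).trans h2

theorem IsStarLike.averageDegree_lt_two (h : G.IsStarLike) : G.averageDegree < 2 := by
  obtain ⟨c, hc⟩ := h
  have hn : 0 < (Fintype.card V : ℝ) := by exact_mod_cast Fintype.card_pos_iff.2 ⟨c⟩
  have h1 : ∑ v, (G.degree v : ℝ) ≤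
      ∑ v, (if v = c then (Fintype.card V : ℝ) - 1 else 1) - 0 := by
    rw [sub_zero]
    refine Finset.sum_le_sum fun v _ => ?_
    split_ifs with hv
    · have := G.degree_lt_card_verts v
      have : (G.degree v : ℝ) + 1 ≤ Fintype.card V := by exact_mod_cast this
      linarith
    · have : G.degree v ≤ 1 := by
        rw [← card_neighborFinset_eq_degree, Finset.card_le_one]
        intro x hx y hy
        rw [mem_neighborFinset] at hx hy
        rw [(hc v x hx).resolve_left hv, (hc v y hy).resolve_left hv]
      exact_mod_cast this
  have h2 : ∑ v : V, (if v = c then (Fintype.card V : ℝ) - 1 else 1)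
      = 2 * Fintype.card V - 2 := by
    have : ∀ v : V, (if v = c then (Fintype.card V : ℝ) - 1 else 1)
        = 1 + if v = c then (Fintype.card V : ℝ) - 2 else 0 := fun v => by split_ifs <;> ring
    simp only [this, Finset.sum_add_distrib, Finset.sum_ite_eq', Finset.mem_univ, if_true]
    simp; ring
  rw [h2, ← averageDegree_mul_card] at h1
  by_contra hlt
  nlinarith [mul_le_mul_of_nonneg_right (not_lt.1 hlt) hn.le]

/-! ### Disconnected graphs -/

section Disconnected

omit [DecidableEq V] in
theorem degree_induce_of_forall_not_adj {X : Set V} [DecidablePred (· ∈ X)]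
    (hX : ∀ x ∈ X, ∀ y ∉ X, ¬ G.Adj x y) (w : X) :
    (G.induce X).degree w = G.degree w := by
  rw [← card_neighborFinset_eq_degree, ← card_neighborFinset_eq_degree,
    ← Finset.card_map (Function.Embedding.subtype (· ∈ X))]
  congr 1
  ext v
  simp only [Finset.mem_map, mem_neighborFinset, comap_adj, Function.Embedding.subtype_apply]
  constructor
  · rintro ⟨v, h, rfl⟩; exact h
  · intro h
    have : v ∈ X := by_contra fun hv => hX w w.2 v hv h
    exact ⟨⟨v, this⟩, h, rfl⟩

/-- A part `X` whose average degree is not below that of `G` decides the matter: a star-like `X`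
together with an edge outside `X` gives a vertex of `X` and a vector `(1, -1)` on that edge. -/
theorem starLike_or_hasTwoAbove_of_part {X : Set V} [DecidablePred (· ∈ X)] (hne : X.Nonempty)
    (hX : ∀ x ∈ X, ∀ y ∉ X, ¬ G.Adj x y)
    (havg : G.averageDegree ≤ (G.induce X).averageDegree)
    (h : (G.induce X).IsStarLike ∨ (G.induce X).HasTwoAbove (G.induce X).averageDegree) :
    G.IsStarLike ∨ G.HasTwoAbove G.averageDegree := by
  rcases h with h | h
  · by_cases hedge : ∃ u v, u ∉ X ∧ v ∉ X ∧ G.Adj u v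
    · right
      obtain ⟨u, v, hu, hv, huv⟩ := hedge
      have := hne.to_subtype
      obtain ⟨w, hw⟩ := (G.induce X).exists_averageDegree_le_degree
      rw [degree_induce_of_forall_not_adj hX] at hw
      have hwu : (w : V) ≠ u := fun h => hu (h ▸ w.2)
      have hwv : (w : V) ≠ v := fun h => hv (h ▸ w.2)
      have h1 : ∀ {p q}, G.Adj p q → (1 : ℝ) ≤ G.degree p := fun {p q} h => by
        exact_mod_cast (G.degree_pos_iff_exists_adj p).2 ⟨q, h⟩
      refine hasTwoAbove_of_orthogonal (x := Pi.single (w : V) 1)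
        (y := Pi.single u 1 - Pi.single v 1) (by simp) ?_ ?_ ?_ ?_ ?_
      · intro h0
        have := congrFun h0 u
        simp [huv.ne] at this
      · simp [hwu, hwv]
      · simp [lapForm_single_of_ne _ hwu, lapForm_single_of_ne _ hwv, hX w w.2 u hu,
          hX w w.2 v hv]
      · simpa [lapForm_single_self] using havg.trans hw
      · have h2 := h.averageDegree_lt_two
        have h3 := h1 huv
        have h4 := h1 huv.symm
        simp only [map_sub, LinearMap.sub_apply, lapForm_single_self, dotProduct_sub,
          lapForm_single_of_ne _ huv.ne, lapForm_single_of_ne _ huv.ne.symm, huv, huv.symm,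
          if_true, sub_dotProduct, single_one_dotProduct, Pi.single_eq_same,
          Pi.single_eq_of_ne huv.ne, Pi.single_eq_of_ne huv.ne.symm]
        linarith
    · left
      obtain ⟨c, hc⟩ := h
      refine ⟨c, fun u v huv => ?_⟩
      by_cases hu : u ∈ X
      · have hv : v ∈ X := by_contra fun hv => hX u hu v hv huv
        simpa [Subtype.ext_iff] using hc ⟨u, hu⟩ ⟨v, hv⟩ huv
      · have hv : v ∉ X := fun hv => hX v hv u hu huv.symm
        exact absurd ⟨u, v, hu, hv, huv⟩ hedge
  · exact Or.inr ((h.of_embedding (Embedding.induce X)).mono havg)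

omit [DecidableEq V] in
/-- The average degree is a weighted mean of those of the two parts. -/
theorem averageDegree_le_induce_or {X : Set V} [DecidablePred (· ∈ X)] (hne : X.Nonempty)
    (hX : ∀ x ∈ X, ∀ y ∉ X, ¬ G.Adj x y) :
    G.averageDegree ≤ (G.induce X).averageDegree ∨
      G.averageDegree ≤ (G.induce Xᶜ).averageDegree := by
  by_contra! h
  have e := G.averageDegree_mul_card
  have e1 := (G.induce X).averageDegree_mul_card
  have e2 := (G.induce Xᶜ).averageDegree_mul_card
  have hX' : ∀ x ∈ Xᶜ, ∀ y ∉ Xᶜ, ¬ G.Adj x y := fun x hx y hy h =>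
    hX y (not_not.1 hy) x hx h.symm
  simp only [degree_induce_of_forall_not_adj hX] at e1
  simp only [degree_induce_of_forall_not_adj hX'] at e2
  have hs := Fintype.sum_subtype_add_sum_subtype (fun v => v ∈ X) fun v => (G.degree v : ℝ)
  have hcard : (Fintype.card X : ℝ) + Fintype.card (Xᶜ : Set V) = Fintype.card V := by
    have := Fintype.sum_subtype_add_sum_subtype (fun v => v ∈ X) fun _ => (1 : ℝ)
    simp only [Finset.sum_const, Finset.card_univ, nsmul_eq_mul, mul_one] at this
    rw [← this]
    congr 2
  have hpos : 0 < (Fintype.card X : ℝ) := by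
    have := hne.to_subtype
    exact_mod_cast Fintype.card_pos
  have h3 : ∑ x : (Xᶜ : Set V), (G.degree x : ℝ) = ∑ x : {x // ¬ x ∈ X}, (G.degree x : ℝ) :=
    Fintype.sum_equiv (Equiv.subtypeEquivRight fun _ => Iff.rfl) _ _ fun _ => rfl
  have h4 : ∑ x : X, (G.degree x : ℝ) = ∑ x : {x // x ∈ X}, (G.degree x : ℝ) := rfl
  rw [h4] at e1
  rw [h3] at e2
  rw [← hs, ← e1, ← e2, ← hcard] at e
  nlinarith [mul_lt_mul_of_pos_right h.1 hpos, mul_le_mul_of_nonneg_right h.2.le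
    (Nat.cast_nonneg (α := ℝ) (Fintype.card (Xᶜ : Set V)))]

end Disconnected

/-! ### Joins -/

section Join

variable {X : Finset V}

/-- In a join on `n` vertices `n` is a Laplacian eigenvalue, with an eigenvector that is constant on
both sides. A vector supported on one side with sum zero is orthogonal to it. -/
theorem hasTwoAbove_of_join (hX : ∀ x ∈ X, ∀ y ∉ X, G.Adj x y) (hne : X.Nonempty)
    (hc : Xᶜ.Nonempty) {g : V → ℝ} (hg0 : g ≠ 0) (hgX : ∀ v ∉ X, g v = 0) (hgs : ∑ v, g v = 0)
    (hga : a * (g ⬝ᵥ g) ≤ G.lapForm g g) (ha : a ≤ Fintype.card V) : G.HasTwoAbove a := by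
  set m : ℝ := (X.card : ℝ) with hm
  set n : ℝ := ((Xᶜ).card : ℝ) with hn
  have hm0 : 0 < m := by rw [hm]; exact_mod_cast hne.card_pos
  have hn0 : 0 < n := by rw [hn]; exact_mod_cast hc.card_pos
  have hmn : m + n = Fintype.card V := by
    rw [hm, hn]; exact_mod_cast Finset.card_add_card_compl X
  set f : V → ℝ := fun v => if v ∈ X then n else -m with hf
  have hfe : (G.lapMatrix ℝ).mulVec f = (m + n) • f := by
    funext v
    rw [lapMatrix_mulVec_apply, Pi.smul_apply, smul_eq_mul]
    have h1 : (G.degree v : ℝ) * f v - ∑ u ∈ G.neighborFinset v, f u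
        = ∑ u, if G.Adj v u then f v - f u else 0 := by
      rw [← Finset.sum_filter, ← neighborFinset_eq_filter, Finset.sum_sub_distrib,
        Finset.sum_const, card_neighborFinset_eq_degree, nsmul_eq_mul]
    rw [h1]
    by_cases hv : v ∈ X
    · have : ∀ u, (if G.Adj v u then f v - f u else 0) = if u ∈ Xᶜ then m + n else 0 := by
        intro u
        by_cases hu : u ∈ X
        · simp [hf, hv, hu]
        · simp [hf, hv, hu, hX v hv u hu]; ring
      simp only [this, Finset.sum_ite_mem, Finset.univ_inter, Finset.sum_const, nsmul_eq_mul]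
      simp only [hf, hv, if_true, ← hn]; ring
    · have : ∀ u, (if G.Adj v u then f v - f u else 0) = if u ∈ X then -(m + n) else 0 := by
        intro u
        by_cases hu : u ∈ X
        · simp [hf, hv, hu, (hX u hu v hv).symm]; ring
        · simp [hf, hv, hu]
      simp only [this, Finset.sum_ite_mem, Finset.univ_inter, Finset.sum_const, nsmul_eq_mul]
      simp only [hf, hv, if_false, ← hm]; ring
  have hf0 : f ≠ 0 := by
    obtain ⟨x, hx⟩ := hne
    intro h
    have := congrFun h x
    simp [hf, hx] at this
    exact hn0.ne' this
  have hgf : g ⬝ᵥ f = 0 := by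
    have : ∀ v, g v * f v = n * g v := fun v => by
      by_cases hv : v ∈ X
      · simp [hf, hv, mul_comm]
      · simp [hgX v hv]
    simp only [dotProduct, this, ← Finset.mul_sum, hgs, mul_zero]
  refine hasTwoAbove_of_orthogonal hg0 hf0 hgf ?_ hga ?_
  · rw [lapForm_apply, hfe, dotProduct_smul, hgf, smul_zero]
  · rw [lapForm_apply, hfe, dotProduct_smul, smul_eq_mul, hmn]
    exact mul_le_mul_of_nonneg_right ha (dotProduct_self_nonneg' _)

theorem card_neighborFinset_inter_add (hX : ∀ x ∈ X, ∀ y ∉ X, G.Adj x y) {u : V} (hu : u ∈ X) :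
    (G.neighborFinset u ∩ X).card + (Xᶜ).card = G.degree u := by
  rw [← card_neighborFinset_eq_degree, ← Finset.card_inter_add_card_sdiff (G.neighborFinset u) X]
  congr 2
  ext v
  simp only [Finset.mem_compl, Finset.mem_sdiff, mem_neighborFinset]
  exact ⟨fun h => ⟨hX u hu v h, h⟩, fun h => h.2⟩

/-- The eigenvector of the star at `u` inside `X`, for its largest eigenvalue. -/
theorem exists_star_vector (hX : ∀ x ∈ X, ∀ y ∉ X, G.Adj x y) {u w : V} (hu : u ∈ X)
    (hw : w ∈ X) (huw : G.Adj u w) :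
    ∃ g : V → ℝ, g ≠ 0 ∧ (∀ v ∉ X, g v = 0) ∧ ∑ v, g v = 0 ∧
      ((G.degree u : ℝ) + 1) * (g ⬝ᵥ g) ≤ G.lapForm g g := by
  set N := G.neighborFinset u ∩ X with hN
  have huN : u ∉ N := by simp [hN]
  set t : ℝ := (N.card : ℝ) with ht
  have ht0 : 0 < t := by
    rw [ht]; exact_mod_cast Finset.card_pos.2 ⟨w, by simp [hN, huw, hw]⟩
  set g : V → ℝ := fun v => (if v = u then t else 0) - if v ∈ N then 1 else 0 with hg
  have hgu : g u = t := by simp [hg, huN]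
  have hgN : ∀ v ∈ N, g v = -1 := fun v hv => by
    have : v ≠ u := fun h => huN (h ▸ hv)
    simp [hg, hv, this]
  have hg0 : ∀ v, v ≠ u → v ∉ N → g v = 0 := fun v h1 h2 => by simp [hg, h1, h2]
  have hgX : ∀ v ∉ X, g v = 0 := fun v hv =>
    hg0 v (fun h => hv (h ▸ hu)) fun h => hv (Finset.mem_inter.1 h).2
  have hsq : ∀ v, g v * g v = (if v = u then t ^ 2 else 0) + if v ∈ N then 1 else 0 := fun v => by
    by_cases h1 : v = u
    · rw [h1]; simp [hgu, huN, sq]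
    · by_cases h2 : v ∈ N
      · simp [hgN v h2, h1, h2]
      · simp [hg0 v h1 h2, h1, h2]
  have hgg : g ⬝ᵥ g = t ^ 2 + t := by
    simp only [dotProduct, hsq, Finset.sum_add_distrib, Finset.sum_ite_eq', Finset.mem_univ,
      if_true, Finset.sum_ite_mem, Finset.univ_inter, Finset.sum_const, nsmul_eq_mul, mul_one, ht]
  refine ⟨g, fun h => ?_, hgX, ?_, ?_⟩
  · rw [h] at hgu; exact ht0.ne hgu
  · simp only [hg, Finset.sum_sub_distrib, Finset.sum_ite_eq', Finset.mem_univ, if_true,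
      Finset.sum_ite_mem, Finset.univ_inter, Finset.sum_const, nsmul_eq_mul, mul_one, ht, sub_self]
  · have hd : (G.degree u : ℝ) = t + (Xᶜ).card := by
      rw [ht]; exact_mod_cast (card_neighborFinset_inter_add hX hu).symm
    set n : ℝ := ((Xᶜ).card : ℝ) with hn
    -- the edges leaving `X` and the edges of the star suffice
    have key : ∀ i j, (if j ∈ Xᶜ then g i * g i else 0) + (if i ∈ Xᶜ then g j * g j else 0)
        + (if i = u then if j ∈ N then (t + 1) ^ 2 else 0 else 0)
        + (if j = u then if i ∈ N then (t + 1) ^ 2 else 0 else 0)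
        ≤ if G.Adj i j then (g i - g j) ^ 2 else 0 := by
      have hNX : ∀ {i}, i ∈ N → i ∈ X := fun h => (Finset.mem_inter.1 h).2
      have hNu : ∀ {i}, i ∈ N → i ≠ u := fun h h' => huN (h' ▸ h)
      have hNa : ∀ {i}, i ∈ N → G.Adj u i := fun h =>
        (G.mem_neighborFinset _ _).1 (Finset.mem_inter.1 h).1
      intro i j
      by_cases hi : i ∈ X <;> by_cases hj : j ∈ X
      · by_cases h1 : i = u
        · by_cases h2 : j ∈ N
          · rw [h1]
            simp [hu, hj, h2, hNu h2, hNa h2, hgu, hgN j h2]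
          · rw [h1]
            simp only [Finset.mem_compl, hu, hj, h2, huN]
            simp; split_ifs <;> positivity
        · by_cases h2 : j = u
          · by_cases h3 : i ∈ N
            · rw [h2]
              simp [hu, hi, h3, h1, (hNa h3).symm, hgu, hgN i h3]
              nlinarith
            · simp [hi, hj, h1, h3]; split_ifs <;> positivity
          · simp [hi, hj, h1, h2]; split_ifs <;> positivity
      · have h1 : j ∉ N := fun h => hj (hNX h)
        have h2 : j ≠ u := fun h => hj (h ▸ hu)
        simp [hi, hj, h1, h2, hX i hi j hj, hgX j hj, sq]
      · have h1 : i ∉ N := fun h => hi (hNX h)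
        have h2 : i ≠ u := fun h => hi (h ▸ hu)
        simp [hi, hj, h1, h2, (hX j hj i hi).symm, hgX i hi, sq]
      · have h1 : i ∉ N := fun h => hi (hNX h)
        have h2 : i ≠ u := fun h => hi (h ▸ hu)
        have h3 : j ≠ u := fun h => hj (h ▸ hu)
        simp [hi, hj, h2, h3, hgX i hi, hgX j hj]
    have hsum := Finset.sum_le_sum fun i (_ : i ∈ Finset.univ) =>
      Finset.sum_le_sum fun j (_ : j ∈ Finset.univ) => key i j
    have e1 : ∑ i : V, ∑ j : V, (if j ∈ Xᶜ then g i * g i else 0) = n * (t ^ 2 + t) := by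
      simp only [Finset.sum_ite_mem, Finset.univ_inter, Finset.sum_const, nsmul_eq_mul,
        ← Finset.mul_sum, ← hgg, dotProduct, hn]
    have e2 : ∑ i : V, ∑ j : V, (if i ∈ Xᶜ then g j * g j else 0) = n * (t ^ 2 + t) := by
      rw [Finset.sum_comm, e1]
    have e3 : ∑ i : V, ∑ j : V, (if i = u then if j ∈ N then (t + 1) ^ 2 else 0 else 0)
        = t * (t + 1) ^ 2 := by
      rw [Finset.sum_comm]
      simp only [Finset.sum_ite_eq', Finset.mem_univ, if_true, Finset.sum_ite_mem,
        Finset.univ_inter, Finset.sum_const, nsmul_eq_mul, ht]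
    have e4 : ∑ i : V, ∑ j : V, (if j = u then if i ∈ N then (t + 1) ^ 2 else 0 else 0)
        = t * (t + 1) ^ 2 := by
      rw [Finset.sum_comm, e3]
    simp only [Finset.sum_add_distrib, e1, e2, e3, e4] at hsum
    rw [lapForm_self, hgg, hd]
    linarith

/-- A vertex `u` of `X` without neighbours in `X` has the least degree in `X`, so that the difference
of `u` and any other vertex of `X` is a suitable vector. -/
theorem exists_difference_vector (hX : ∀ x ∈ X, ∀ y ∉ X, G.Adj x y) {u v : V} (hu : u ∈ X)
    (hv : v ∈ X) (huv : u ≠ v) (hiso : ∀ w ∈ X, ¬ G.Adj u w) :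
    ∃ g : V → ℝ, g ≠ 0 ∧ (∀ v ∉ X, g v = 0) ∧ ∑ v, g v = 0 ∧
      (G.degree u : ℝ) * (g ⬝ᵥ g) ≤ G.lapForm g g := by
  have h1 : G.degree u ≤ G.degree v := by
    have h2 := card_neighborFinset_inter_add hX hu
    have h3 := card_neighborFinset_inter_add hX hv
    have h4 : G.neighborFinset u ∩ X = ∅ := by
      ext w; simpa using fun h hw => hiso w hw h
    rw [h4, Finset.card_empty] at h2
    omega
  have h1' : (G.degree u : ℝ) ≤ G.degree v := by exact_mod_cast h1
  refine ⟨Pi.single u 1 - Pi.single v 1, fun h => ?_, fun w hw => ?_, by simp, ?_⟩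
  · have := congrFun h u
    simp [huv] at this
  · have e1 : w ≠ u := fun h => hw (h ▸ hu)
    have e2 : w ≠ v := fun h => hw (h ▸ hv)
    simp [e1, e2]
  · have e1 := hiso v hv
    have e2 : ¬ G.Adj v u := fun h => e1 h.symm
    simp only [map_sub, LinearMap.sub_apply, lapForm_single_self, dotProduct_sub,
      lapForm_single_of_ne _ huv, lapForm_single_of_ne _ huv.symm, e1, e2,
      if_false, sub_dotProduct, single_one_dotProduct, Pi.single_eq_same,
      Pi.single_eq_of_ne huv, Pi.single_eq_of_ne huv.symm]
    linarith

theorem hasTwoAbove_of_join_max (hX : ∀ x ∈ X, ∀ y ∉ X, G.Adj x y) (h2 : 2 ≤ X.card)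
    (hc : Xᶜ.Nonempty) {u : V} (hu : u ∈ X) (hmax : ∀ v, G.degree v ≤ G.degree u) :
    G.HasTwoAbove G.averageDegree := by
  have hne : X.Nonempty := ⟨u, hu⟩
  have : Nonempty V := ⟨u⟩
  obtain ⟨v, hv⟩ := G.exists_averageDegree_le_degree
  have hav : G.averageDegree ≤ G.degree u := hv.trans (by exact_mod_cast hmax v)
  have hlt : (G.degree u : ℝ) + 1 ≤ Fintype.card V := by exact_mod_cast G.degree_lt_card_verts u
  by_cases h : ∃ w ∈ X, G.Adj u w
  · obtain ⟨w, hw, huw⟩ := h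
    obtain ⟨g, hg0, hgX, hgs, hga⟩ := exists_star_vector hX hu hw huw
    exact (hasTwoAbove_of_join hX hne hc hg0 hgX hgs hga hlt).mono (by linarith)
  · push Not at h
    obtain ⟨w, hw, hwu⟩ := Finset.exists_mem_ne h2 u
    obtain ⟨g, hg0, hgX, hgs, hga⟩ := exists_difference_vector hX hu hw hwu.symm h
    exact (hasTwoAbove_of_join hX hne hc hg0 hgX hgs hga (by linarith)).mono hav

/-- If `u` has the largest degree `d` away from `c`, then the star at `u` has Rayleigh quotient at
least `d + 1`, and the degree sum is at most `(n - 1) + (n - 1) * d = (n - 1) * (d + 1)`. -/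
theorem starLike_or_hasTwoAbove_of_universal {c : V} (hc : ∀ v, v ≠ c → G.Adj c v) :
    G.IsStarLike ∨ G.HasTwoAbove G.averageDegree := by
  by_cases hedge : ∃ u w, u ≠ c ∧ w ≠ c ∧ G.Adj u w
  · right
    obtain ⟨u₀, w₀, hu₀, hw₀, h₀⟩ := hedge
    set X : Finset V := Finset.univ.erase c with hXdef
    have hmem : ∀ v, v ∈ X ↔ v ≠ c := fun v => by simp [hXdef]
    have hX : ∀ x ∈ X, ∀ y ∉ X, G.Adj x y := fun x hx y hy => by
      rw [hmem] at hx hy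
      rw [not_not.1 hy]
      exact (hc x hx).symm
    have hcX : Xᶜ = {c} := by ext v; simp [hmem]
    obtain ⟨u, hu, hmax⟩ := X.exists_max_image (fun v => G.degree v) ⟨u₀, (hmem _).2 hu₀⟩
    have hdeg : ∀ x ∈ X, (G.neighborFinset x ∩ X).card + 1 = G.degree x := fun x hx => by
      have := card_neighborFinset_inter_add hX hx
      rwa [hcX, Finset.card_singleton] at this
    obtain ⟨w, hw⟩ : (G.neighborFinset u ∩ X).Nonempty := by
      have h1 := hmax u₀ ((hmem _).2 hu₀)
      rw [← hdeg u hu, ← hdeg u₀ ((hmem _).2 hu₀)] at h1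
      have h2 : 0 < (G.neighborFinset u₀ ∩ X).card :=
        Finset.card_pos.2 ⟨w₀, by simp [h₀, hmem, hw₀]⟩
      exact Finset.card_pos.1 (by omega)
    rw [Finset.mem_inter, mem_neighborFinset] at hw
    obtain ⟨g, hg0, hgX, hgs, hga⟩ := exists_star_vector hX hu hw.2 hw.1
    have hlt : (G.degree u : ℝ) + 1 ≤ Fintype.card V := by
      exact_mod_cast G.degree_lt_card_verts u
    refine (hasTwoAbove_of_join hX ⟨u, hu⟩ (by simp [hcX]) hg0 hgX hgs hga hlt).mono ?_
    have hn : 0 < (Fintype.card V : ℝ) := by exact_mod_cast Fintype.card_pos_iff.2 ⟨c⟩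
    have hsum : ∑ v, (G.degree v : ℝ) ≤ (Fintype.card V - 1) * (G.degree u + 1) := by
      rw [← Finset.add_sum_erase _ _ (Finset.mem_univ c)]
      have h1 : (G.degree c : ℝ) ≤ Fintype.card V - 1 := by
        have : (G.degree c : ℝ) + 1 ≤ Fintype.card V := by
          exact_mod_cast G.degree_lt_card_verts c
        linarith
      have h2 : ∑ v ∈ X, (G.degree v : ℝ) ≤ ∑ v ∈ X, (G.degree u : ℝ) :=
        Finset.sum_le_sum fun v hv => by exact_mod_cast hmax v hv
      have h3 : (X.card : ℝ) = Fintype.card V - 1 := by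
        rw [hXdef, Finset.card_erase_of_mem (Finset.mem_univ c), Finset.card_univ,
          Nat.cast_sub (Fintype.card_pos_iff.2 ⟨c⟩), Nat.cast_one]
      rw [Finset.sum_const, nsmul_eq_mul, h3] at h2
      linarith
    rw [← averageDegree_mul_card] at hsum
    by_contra hlt'
    nlinarith [mul_lt_mul_of_pos_right (not_le.1 hlt') hn,
      Nat.cast_nonneg (α := ℝ) (G.degree u)]
  · left
    refine ⟨c, fun u v huv => ?_⟩
    by_contra! h
    exact hedge ⟨u, v, h.1, h.2, huv⟩

/-- The side of a vertex of maximum degree has at least two vertices, unless one of the sides is a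
single vertex, which is then adjacent to all others. -/
theorem starLike_or_hasTwoAbove_of_join (hX : ∀ x ∈ X, ∀ y ∉ X, G.Adj x y) (hne : X.Nonempty)
    (hc : Xᶜ.Nonempty) : G.IsStarLike ∨ G.HasTwoAbove G.averageDegree := by
  have hX' : ∀ x ∈ Xᶜ, ∀ y ∉ Xᶜ, G.Adj x y := fun x hx y hy =>
    (hX y (by simpa using hy) x (by simpa using hx)).symm
  by_cases h1 : X.card = 1
  · obtain ⟨c, rfl⟩ := Finset.card_eq_one.1 h1
    exact starLike_or_hasTwoAbove_of_universal fun v hv => hX c (by simp) v (by simpa)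
  by_cases h2 : (Xᶜ).card = 1
  · obtain ⟨c, hc'⟩ := Finset.card_eq_one.1 h2
    refine starLike_or_hasTwoAbove_of_universal (c := c) fun v hv => ?_
    exact hX' c (by simp [hc']) v (by simp [hc', hv])
  have h3 := hne.card_pos
  have h4 := hc.card_pos
  right
  obtain ⟨u, -, hmax⟩ :=
    Finset.univ.exists_max_image (fun v => G.degree v) ⟨hne.choose, Finset.mem_univ _⟩
  by_cases hu : u ∈ X
  · exact hasTwoAbove_of_join_max hX (by omega) hc hu fun v => hmax v (Finset.mem_univ v)
  · exact hasTwoAbove_of_join_max hX' (by omega) (by simpa) (Finset.mem_compl.2 hu) fun v =>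
      hmax v (Finset.mem_univ v)

end Join

end Subgraphs

/-! ### Extended P₄-laden graphs in terms of vertices -/

section Laden

variable {V : Type*}

/-- `a - b - c - d` is an induced path. The adjacencies and non-adjacencies make the four
vertices distinct. -/
def IsP4 (G : SimpleGraph V) (a b c d : V) : Prop :=
  G.Adj a b ∧ G.Adj b c ∧ G.Adj c d ∧ ¬ G.Adj a c ∧ ¬ G.Adj b d ∧ ¬ G.Adj a d

/-- `ab` and `cd` are the edges of an induced `2K₂`. -/
def IsTwoK2 (G : SimpleGraph V) (a b c d : V) : Prop :=
  G.Adj a b ∧ G.Adj c d ∧ ¬ G.Adj a c ∧ ¬ G.Adj a d ∧ ¬ G.Adj b c ∧ ¬ G.Adj b d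

/-- `a b c d` is an induced 4-cycle. -/
def IsC4 (G : SimpleGraph V) (a b c d : V) : Prop :=
  G.Adj a b ∧ G.Adj b c ∧ G.Adj c d ∧ G.Adj d a ∧ ¬ G.Adj a c ∧ ¬ G.Adj b d ∧ a ≠ c ∧ b ≠ d

theorem IsP4.compl {G : SimpleGraph V} {a b c d : V} (h : Gᶜ.IsP4 a b c d) :
    G.IsP4 b d a c := by
  obtain ⟨h1, h2, h3, h4, h5, h6⟩ := h
  have n1 : a ≠ c := by rintro rfl; exact h6 h3
  have n2 : b ≠ d := by rintro rfl; exact h6 h1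
  have n3 : a ≠ d := by rintro rfl; exact h4 h3.symm
  rw [compl_adj] at h1 h2 h3 h4 h5 h6
  simp only [n1, n2, n3, ne_eq, not_false_eq_true, true_and, not_not] at h4 h5 h6
  exact ⟨h5, h6.symm, h4, fun h => h1.2 h.symm, fun h => h3.2 h.symm, h2.2⟩

theorem IsP4.to_compl {G : SimpleGraph V} {a b c d : V} (h : G.IsP4 a b c d) :
    Gᶜ.IsP4 b d a c :=
  IsP4.compl (by rwa [compl_compl])

theorem IsTwoK2.compl {G : SimpleGraph V} {a b c d : V} (h : Gᶜ.IsTwoK2 a b c d) :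
    G.IsC4 a c b d := by
  obtain ⟨h1, h2, h3, h4, h5, h6⟩ := h
  have n1 : a ≠ c := by rintro rfl; exact h4 h2
  have n2 : b ≠ d := by rintro rfl; exact h4 h1
  have n3 : a ≠ d := by rintro rfl; exact h3 h2.symm
  have n4 : b ≠ c := by rintro rfl; exact h3 h1
  rw [compl_adj] at h1 h2 h3 h4 h5 h6
  simp only [n1, n2, n3, n4, ne_eq, not_false_eq_true, true_and, not_not] at h3 h4 h5 h6
  exact ⟨h3, h5.symm, h6, h4.symm, h1.2, h2.2, h1.1, h2.1⟩

theorem IsC4.compl {G : SimpleGraph V} {a b c d : V} (h : Gᶜ.IsC4 a b c d) :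
    G.IsTwoK2 a c b d := by
  obtain ⟨h1, h2, h3, h4, h5, h6, n1, n2⟩ := h
  rw [compl_adj] at h1 h2 h3 h4 h5 h6
  simp only [n1, n2, ne_eq, not_false_eq_true, true_and, not_not] at h5 h6
  exact ⟨h5, h6, h1.2, fun h => h4.2 h.symm, fun h => h2.2 h.symm, h3.2⟩

/-- The set `p` induces a `P₄`. -/
def IsP4Set (G : SimpleGraph V) (p : Finset V) : Prop :=
  ∃ a b c d, (∀ v, v ∈ p ↔ v = a ∨ v = b ∨ v = c ∨ v = d) ∧ G.IsP4 a b c d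

/-- A form of extended `P₄`-ladenness that speaks of vertices and vertex sets only: a set of at
most six vertices containing three `P₄`'s contains neither a `2K₂` nor a `C₄`. -/
def IsLaden (G : SimpleGraph V) : Prop :=
  ∀ W p q r : Finset V, W.card ≤ 6 → p ⊆ W → q ⊆ W → r ⊆ W → p ≠ q → p ≠ r → q ≠ r →
    G.IsP4Set p → G.IsP4Set q → G.IsP4Set r →
    ∀ a ∈ W, ∀ b ∈ W, ∀ c ∈ W, ∀ d ∈ W, ¬ G.IsTwoK2 a b c d ∧ ¬ G.IsC4 a b c d

theorem IsLaden.compl {G : SimpleGraph V} (h : G.IsLaden) : Gᶜ.IsLaden := by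
  have key : ∀ p : Finset V, Gᶜ.IsP4Set p → G.IsP4Set p := by
    rintro p ⟨a, b, c, d, hv, hp⟩
    exact ⟨b, d, a, c, fun v => by rw [hv]; tauto, hp.compl⟩
  intro W p q r hW hp hq hr hpq hpr hqr hp4 hq4 hr4 a ha b hb c hc d hd
  have H := h W p q r hW hp hq hr hpq hpr hqr (key p hp4) (key q hq4) (key r hr4)
  exact ⟨fun h' => (H a ha c hc b hb d hd).2 h'.compl, fun h' =>
    (H a ha c hc b hb d hd).1 h'.compl⟩

theorem IsLaden.of_embedding {W : Type*} {G : SimpleGraph V} {H : SimpleGraph W} (f : H ↪g G)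
    (h : G.IsLaden) : H.IsLaden := by
  have key : ∀ p : Finset W, H.IsP4Set p → G.IsP4Set (p.map f.toEmbedding) := by
    rintro p ⟨a, b, c, d, hv, hp⟩
    refine ⟨f a, f b, f c, f d, fun v => ?_, ?_⟩
    · simp [hv, eq_comm]
    · simpa only [IsP4, f.map_adj_iff] using hp
  intro U p q r hU hp hq hr hpq hpr hqr hp4 hq4 hr4 a ha b hb c hc d hd
  have H' := h (U.map f.toEmbedding) (p.map f.toEmbedding) (q.map f.toEmbedding)
    (r.map f.toEmbedding) (by rwa [Finset.card_map]) (Finset.map_subset_map.2 hp)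
    (Finset.map_subset_map.2 hq) (Finset.map_subset_map.2 hr)
    (fun h => hpq (Finset.map_injective _ h)) (fun h => hpr (Finset.map_injective _ h))
    (fun h => hqr (Finset.map_injective _ h)) (key p hp4) (key q hq4) (key r hr4)
    (f a) (Finset.mem_map_of_mem _ ha) (f b) (Finset.mem_map_of_mem _ hb)
    (f c) (Finset.mem_map_of_mem _ hc) (f d) (Finset.mem_map_of_mem _ hd)
  simpa only [IsTwoK2, IsC4, f.map_adj_iff, f.injective.ne_iff] using H'

theorem IsP4.nonempty_embedding {G : SimpleGraph V} {a b c d : V} (h : G.IsP4 a b c d) :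
    ∃ f : pathGraph 4 ↪g G, Set.range f = {a, b, c, d} := by
  obtain ⟨h1, h2, h3, h4, h5, h6⟩ := h
  have n1 : a ≠ c := by rintro rfl; exact h6 h3
  have n2 : b ≠ d := by rintro rfl; exact h6 h1
  have n3 : a ≠ d := by rintro rfl; exact h4 h3.symm
  have hinj : Function.Injective ![a, b, c, d] := by
    intro i j
    fin_cases i <;> fin_cases j <;>
      simp [n1, n2, n3, n1.symm, n2.symm, n3.symm, h1.ne, h2.ne, h3.ne, h1.ne.symm, h2.ne.symm,
        h3.ne.symm]
  have hadj : ∀ i j, G.Adj (![a, b, c, d] i) (![a, b, c, d] j) ↔ (pathGraph 4).Adj i j := by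
    intro i j
    fin_cases i <;> fin_cases j <;>
      simp [pathGraph_adj, h1, h2, h3, h4, h5, h6, h1.symm, h2.symm, h3.symm,
        G.adj_comm c a, G.adj_comm d b, G.adj_comm d a]
  refine ⟨⟨⟨_, hinj⟩, hadj _ _⟩, ?_⟩
  change Set.range ![a, b, c, d] = _
  ext v
  simp [eq_comm]
  tauto

theorem IsTwoK2.isIndContained {G : SimpleGraph V} {a b c d : V} (h : G.IsTwoK2 a b c d) :
    twoK2.IsIndContained G := by
  obtain ⟨h1, h2, h3, h4, h5, h6⟩ := h
  have n1 : a ≠ c := by rintro rfl; exact h4 h2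
  have n2 : b ≠ d := by rintro rfl; exact h4 h1
  have n3 : a ≠ d := by rintro rfl; exact h3 h2.symm
  have n4 : b ≠ c := by rintro rfl; exact h3 h1
  have hinj : Function.Injective (Sum.elim ![a, b] ![c, d]) := by
    rintro (i | i) (j | j) <;> fin_cases i <;> fin_cases j <;>
      simp [n1, n2, n3, n4, n1.symm, n2.symm, n3.symm, n4.symm, h1.ne, h2.ne, h1.ne.symm,
        h2.ne.symm]
  have hadj : ∀ i j, G.Adj (Sum.elim ![a, b] ![c, d] i) (Sum.elim ![a, b] ![c, d] j) ↔
      twoK2.Adj i j := by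
    rintro (i | i) (j | j) <;> fin_cases i <;> fin_cases j <;>
      simp [twoK2, h1, h2, h3, h4, h5, h6, h1.symm, h2.symm, G.adj_comm c a, G.adj_comm d b,
        G.adj_comm d a, G.adj_comm c b]
  exact ⟨⟨⟨_, hinj⟩, hadj _ _⟩⟩

theorem IsC4.isIndContained {G : SimpleGraph V} {a b c d : V} (h : G.IsC4 a b c d) :
    (cycleGraph 4).IsIndContained G := by
  obtain ⟨h1, h2, h3, h4, h5, h6, n1, n2⟩ := h
  have hinj : Function.Injective ![a, b, c, d] := by
    intro i j
    fin_cases i <;> fin_cases j <;>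
      simp [n1, n2, n1.symm, n2.symm, h1.ne, h2.ne, h3.ne, h4.ne, h1.ne.symm, h2.ne.symm,
        h3.ne.symm, h4.ne.symm]
  have hadj : ∀ i j, G.Adj (![a, b, c, d] i) (![a, b, c, d] j) ↔ (cycleGraph 4).Adj i j := by
    intro i j
    rw [cycleGraph_adj]
    fin_cases i <;> fin_cases j <;>
      simp [h1, h2, h3, h4, h5, h6, h1.symm, h2.symm, h3.symm, h4.symm,
        G.adj_comm c a, G.adj_comm d b] <;> decide
  exact ⟨⟨⟨_, hinj⟩, hadj _ _⟩⟩

/-- Only one direction is needed: three different induced `P₄`'s and a `2K₂` or `C₄` inside `W`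
are found again in the induced subgraph on `W`. -/
theorem IsExtendedP4Laden.isLaden {G : SimpleGraph V} (h : G.IsExtendedP4Laden) :
    G.IsLaden := by
  intro W p q r hW hp hq hr hpq hpr hqr hp4 hq4 hr4
  set H := G.induce (W : Set V)
  set pre : Finset V → Set (W : Set V) := fun s => {w | (w : V) ∈ s} with hpre
  have hset : ∀ s : Finset V, s ⊆ W → G.IsP4Set s →
      pre s ∈ {X : Set (W : Set V) | Nonempty (H.induce X ≃g pathGraph 4)} := by
    rintro s hs ⟨a, b, c, d, hv, hs4⟩
    have ha : a ∈ (W : Set V) := hs (by simp [hv])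
    have hb : b ∈ (W : Set V) := hs (by simp [hv])
    have hc : c ∈ (W : Set V) := hs (by simp [hv])
    have hd : d ∈ (W : Set V) := hs (by simp [hv])
    have h4 : H.IsP4 ⟨a, ha⟩ ⟨b, hb⟩ ⟨c, hc⟩ ⟨d, hd⟩ := hs4
    obtain ⟨f, hf⟩ := h4.nonempty_embedding
    have : pre s = Set.range f := by
      rw [hf]; ext w; simp [hpre, hv, Subtype.ext_iff]
    rw [this]
    exact ⟨f.isoInduceRange.symm⟩
  have hinj : ∀ s t : Finset V, s ⊆ W → t ⊆ W → s ≠ t → pre s ≠ pre t := by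
    intro s t hs ht hst h
    refine hst (Finset.ext fun v => ⟨fun hv => ?_, fun hv => ?_⟩)
    · have : (⟨v, hs hv⟩ : (W : Set V)) ∈ pre s := hv
      rw [h] at this; exact this
    · have : (⟨v, ht hv⟩ : (W : Set V)) ∈ pre t := hv
      rw [← h] at this; exact this
  have hcount : 2 < numInducedP4 H := by
    unfold numInducedP4
    rw [Set.two_lt_ncard_iff (Set.toFinite _)]
    exact ⟨pre p, pre q, pre r, hset p hp hp4, hset q hq hq4, hset r hr hr4,
      hinj p q hp hq hpq, hinj p r hp hr hpr, hinj q r hq hr hqr⟩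
  obtain ⟨h2, hC⟩ := h W hW hcount
  intro a ha b hb c hc d hd
  refine ⟨fun h' => h2 ?_, fun h' => hC ?_⟩
  · have : H.IsTwoK2 ⟨a, ha⟩ ⟨b, hb⟩ ⟨c, hc⟩ ⟨d, hd⟩ := h'
    exact this.isIndContained
  · have : H.IsC4 ⟨a, ha⟩ ⟨b, hb⟩ ⟨c, hc⟩ ⟨d, hd⟩ := by
      obtain ⟨h1, h2, h3, h4, h5, h6, n1, n2⟩ := h'
      exact ⟨h1, h2, h3, h4, h5, h6, by simpa using n1, by simpa using n2⟩
    exact this.isIndContained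

end Laden

/-! ### Forbidden graphs on six vertices -/

section SixVertices

variable {V : Type*} {G : SimpleGraph V}

/-- Boolean test for an induced path in the graph with adjacency table `A`. -/
def boolP4 {n : ℕ} (A : Fin n → Fin n → Bool) (a b c d : Fin n) : Bool :=
  A a b && A b c && A c d && !A a c && !A b d && !A a d

/-- Boolean test whether four vertices induce a `P₄` in some order. -/
def boolP4Set {n : ℕ} (A : Fin n → Fin n → Bool) : Fin n × Fin n × Fin n × Fin n → Bool
  | (a, b, c, d) =>
    boolP4 A a b c d || boolP4 A a b d c || boolP4 A a c b d || boolP4 A a c d b ||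
    boolP4 A a d b c || boolP4 A a d c b || boolP4 A b a c d || boolP4 A b a d c ||
    boolP4 A b c a d || boolP4 A b d a c || boolP4 A c a b d || boolP4 A c b a d

/-- Boolean test whether four distinct vertices induce a `2K₂` or a `C₄` in this order. -/
def boolTwoK2OrC4 {n : ℕ} (A : Fin n → Fin n → Bool) (a b c d : Fin n) : Bool :=
  (A a b && A c d && !A a c && !A a d && !A b c && !A b d) ||
  (A a b && A b c && A c d && A d a && !A a c && !A b d)

/-- Boolean test whether four distinct vertices induce a `2K₂` or a `C₄` in some order. -/
def boolTwoK2OrC4Set {n : ℕ} (A : Fin n → Fin n → Bool) :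
    Fin n × Fin n × Fin n × Fin n → Bool
  | (a, b, c, d) => boolTwoK2OrC4 A a b c d || boolTwoK2OrC4 A a c b d ||
    boolTwoK2OrC4 A a b d c || boolTwoK2OrC4 A a d b c

/-- The four-element subsets of a six-element set. -/
def quadruples : List (Fin 6 × Fin 6 × Fin 6 × Fin 6) :=
  [(0, 1, 2, 3), (0, 1, 2, 4), (0, 1, 2, 5), (0, 1, 3, 4), (0, 1, 3, 5), (0, 1, 4, 5),
   (0, 2, 3, 4), (0, 2, 3, 5), (0, 2, 4, 5), (0, 3, 4, 5), (1, 2, 3, 4), (1, 2, 3, 5),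
   (1, 2, 4, 5), (1, 3, 4, 5), (2, 3, 4, 5)]

/-- Boolean test for six vertices that contain three `P₄`'s and a `2K₂` or a `C₄`. -/
def boolNotLaden (A : Fin 6 → Fin 6 → Bool) : Bool :=
  decide (3 ≤ (quadruples.filter (boolP4Set A)).length) && quadruples.any (boolTwoK2OrC4Set A)

/-- The set of entries of a quadruple. -/
def quadrupleSet {n : ℕ} : Fin n × Fin n × Fin n × Fin n → Finset (Fin n)
  | (a, b, c, d) => {a, b, c, d}

theorem boolP4_spec {n : ℕ} {A : Fin n → Fin n → Bool} {f : Fin n → V}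
    (hA : ∀ i j, G.Adj (f i) (f j) ↔ A i j = true) {a b c d : Fin n}
    (h : boolP4 A a b c d = true) : G.IsP4 (f a) (f b) (f c) (f d) := by
  simp only [boolP4, Bool.and_eq_true, Bool.not_eq_true'] at h
  simp only [IsP4, hA]
  simp_all

theorem boolP4Set_spec [DecidableEq V] {n : ℕ} {A : Fin n → Fin n → Bool} {f : Fin n → V}
    (hA : ∀ i j, G.Adj (f i) (f j) ↔ A i j = true) {x : Fin n × Fin n × Fin n × Fin n}
    (h : boolP4Set A x = true) : G.IsP4Set ((quadrupleSet x).image f) := by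
  obtain ⟨a, b, c, d⟩ := x
  have key : ∀ a' b' c' d', ({a, b, c, d} : Finset (Fin n)) = {a', b', c', d'} →
      boolP4 A a' b' c' d' = true → G.IsP4Set ((quadrupleSet (a, b, c, d)).image f) := by
    intro a' b' c' d' he h'
    refine ⟨f a', f b', f c', f d', fun v => ?_, boolP4_spec hA h'⟩
    simp only [quadrupleSet, he, Finset.image_insert, Finset.image_singleton, Finset.mem_insert,
      Finset.mem_singleton]
  simp only [boolP4Set, Bool.or_eq_true] at h
  rcases h with (((((((((((h | h) | h) | h) | h) | h) | h) | h) | h) | h) | h) | h) <;>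
    refine key _ _ _ _ ?_ h <;>
    first | rfl | (ext; simp only [Finset.mem_insert, Finset.mem_singleton]; tauto)

theorem boolTwoK2OrC4_spec {n : ℕ} {A : Fin n → Fin n → Bool} {f : Fin n → V}
    (hf : Function.Injective f)
    (hA : ∀ i j, G.Adj (f i) (f j) ↔ A i j = true) {a b c d : Fin n} (hac : a ≠ c) (hbd : b ≠ d)
    (h : boolTwoK2OrC4 A a b c d = true) :
    G.IsTwoK2 (f a) (f b) (f c) (f d) ∨ G.IsC4 (f a) (f b) (f c) (f d) := by
  simp only [boolTwoK2OrC4, Bool.or_eq_true, Bool.and_eq_true, Bool.not_eq_true'] at h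
  simp only [IsTwoK2, IsC4, hA, hf.ne_iff]
  rcases h with h | h
  · left; simp_all
  · right; simp_all

theorem IsLaden.false_of_six (hG : G.IsLaden) {A : Fin 6 → Fin 6 → Bool} {f : Fin 6 → V}
    (hf : Function.Injective f) (hA : ∀ i j, G.Adj (f i) (f j) ↔ A i j = true)
    (h : boolNotLaden A = true) : False := by
  classical
  simp only [boolNotLaden, Bool.and_eq_true, decide_eq_true_eq, List.any_eq_true] at h
  obtain ⟨h3, x, hx, hx'⟩ := h
  set L := quadruples.filter (boolP4Set A) with hL
  have hnd : (L.map quadrupleSet).Nodup :=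
    List.Nodup.sublist (List.Sublist.map _ List.filter_sublist) (by decide)
  have hmem : ∀ i (hi : i < L.length), boolP4Set A L[i] = true := fun i hi =>
    (List.mem_filter.1 (List.getElem_mem hi)).2
  have hne : ∀ i j (hi : i < L.length) (hj : j < L.length), i ≠ j →
      (quadrupleSet L[i]).image f ≠ (quadrupleSet L[j]).image f := by
    intro i j hi hj hij h
    have h' := Finset.image_injective hf h
    refine hij ((List.Nodup.getElem_inj_iff hnd (hi := by simpa) (hj := by simpa)).1 ?_)
    simpa using h'
  have H := hG (Finset.univ.image f) _ _ _ (Finset.card_image_le.trans (by simp))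
    (Finset.image_subset_image (Finset.subset_univ _))
    (Finset.image_subset_image (Finset.subset_univ _))
    (Finset.image_subset_image (Finset.subset_univ _))
    (hne 0 1 (by omega) (by omega) (by omega)) (hne 0 2 (by omega) (by omega) (by omega))
    (hne 1 2 (by omega) (by omega) (by omega)) (boolP4Set_spec hA (hmem 0 (by omega)))
    (boolP4Set_spec hA (hmem 1 (by omega))) (boolP4Set_spec hA (hmem 2 (by omega)))
  have H' : ∀ a b c d : Fin 6, a ≠ c → b ≠ d → boolTwoK2OrC4 A a b c d = true → False := by
    intro a b c d hac hbd h
    have h1 := H (f a) (by simp) (f b) (by simp) (f c) (by simp) (f d) (by simp)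
    exact (boolTwoK2OrC4_spec hf hA hac hbd h).elim h1.1 h1.2
  obtain ⟨a, b, c, d⟩ := x
  have hd : a ≠ b ∧ a ≠ c ∧ a ≠ d ∧ b ≠ c ∧ b ≠ d ∧ c ≠ d := by
    clear hx'
    revert hx; revert a b c d; decide
  obtain ⟨h1, h2, h3, h4, h5, h6⟩ := hd
  simp only [boolTwoK2OrC4Set, Bool.or_eq_true] at hx'
  rcases hx' with ((h | h) | h) | h
  · exact H' _ _ _ _ h2 h5 h
  · exact H' _ _ _ _ h1 h6 h
  · exact H' _ _ _ _ h3 h4 h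
  · exact H' _ _ _ _ h1 h6.symm h

theorem adj_iff_of_lt {n : ℕ} {A : Fin n → Fin n → Bool} {f : Fin n → V}
    (h0 : ∀ i, A i i = false) (hs : ∀ i j, A i j = A j i)
    (h : ∀ i j, i < j → (G.Adj (f i) (f j) ↔ A i j = true)) (i j : Fin n) :
    G.Adj (f i) (f j) ↔ A i j = true := by
  rcases lt_trichotomy i j with hij | rfl | hij
  · exact h i j hij
  · simp [h0]
  · rw [G.adj_comm, h j i hij, hs]

theorem injective_of_rows {n : ℕ} {A : Fin n → Fin n → Bool} {f : Fin n → V}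
    (hA : ∀ i j, G.Adj (f i) (f j) ↔ A i j = true)
    (hr : ∀ i j, (∀ k, A i k = A j k) → i = j) : Function.Injective f := by
  refine fun i j hij => hr i j fun k => ?_
  have := hA i k
  rw [hij, hA j k] at this
  exact Bool.eq_iff_iff.2 this.symm

/-- The adjacency table `A` on five vertices, extended by a sixth vertex with row `b`. -/
def extendTable (A : Fin 5 → Fin 5 → Bool) (b : Fin 5 → Bool) : Fin 6 → Fin 6 → Bool :=
  Fin.cons (Fin.cons false b) fun i => Fin.cons (b i) (A i)

/-- If every proper extension of a five-vertex graph to six vertices has three `P₄`'s and a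
`2K₂` or a `C₄`, then in a laden graph a copy of that graph is seen uniformly from outside. -/
theorem IsLaden.uniform_of_five (hG : G.IsLaden) {A : Fin 5 → Fin 5 → Bool} {f : Fin 5 → V}
    (hA : ∀ i j, G.Adj (f i) (f j) ↔ A i j = true)
    (hr : ∀ i j, (∀ k, A i k = A j k) → i = j)
    (hext : ∀ b₀ b₁ b₂ b₃ b₄ : Bool, boolNotLaden (extendTable A ![b₀, b₁, b₂, b₃, b₄]) = true ∨
      (b₀ = b₁ ∧ b₁ = b₂ ∧ b₂ = b₃ ∧ b₃ = b₄)) {v : V} (hv : v ∉ Set.range f) (i j : Fin 5) :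
    G.Adj v (f i) ↔ G.Adj v (f j) := by
  classical
  set b : Fin 5 → Bool := fun i => decide (G.Adj v (f i)) with hb
  have hbe : b = ![b 0, b 1, b 2, b 3, b 4] := by
    funext k; fin_cases k <;> rfl
  have hinj : Function.Injective (Fin.cons v f : Fin 6 → V) :=
    Fin.cons_injective_iff.2 ⟨hv, injective_of_rows hA hr⟩
  have hA' : ∀ i j : Fin 6, G.Adj ((Fin.cons v f : Fin 6 → V) i) ((Fin.cons v f : Fin 6 → V) j) ↔
      extendTable A b i j = true := by
    intro i j
    refine Fin.cases ?_ (fun i => ?_) i <;> refine Fin.cases ?_ (fun j => ?_) j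
    · simp [extendTable]
    · simp [extendTable, hb]
    · simp [extendTable, hb, G.adj_comm]
    · simp [extendTable, hA]
  have hall : ∀ k, b k = b 0 := by
    rcases hext (b 0) (b 1) (b 2) (b 3) (b 4) with h | ⟨h1, h2, h3, h4⟩
    · rw [← hbe] at h
      exact (hG.false_of_six hinj hA' h).elim
    · intro k
      fin_cases k <;> simp [h1, h2, h3, h4]
  have := (hall i).trans (hall j).symm
  simpa [hb] using this

end SixVertices

/-! ### Modules and prime quotients -/

section Modules

variable {V : Type*} {G : SimpleGraph V}

/-- A module: a vertex set that every outside vertex sees uniformly. -/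
def IsModule (G : SimpleGraph V) (X : Set V) : Prop :=
  ∀ u ∈ X, ∀ v ∈ X, ∀ w ∉ X, G.Adj w u ↔ G.Adj w v

/-- Connectedness in terms of cuts; the graph without vertices is admitted. -/
def CutConnected (G : SimpleGraph V) : Prop :=
  ∀ X : Set V, X.Nonempty → Xᶜ.Nonempty → ∃ x ∈ X, ∃ y ∉ X, G.Adj x y

/-- A prime graph: every module has at most one vertex or is the whole vertex set. -/
def IsPrimeGraph (G : SimpleGraph V) : Prop :=
  ∀ X : Set V, G.IsModule X → X.Nontrivial → X = Set.univ

theorem IsModule.compl {X : Set V} (h : G.IsModule X) : Gᶜ.IsModule X := by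
  intro u hu v hv w hw
  have h1 : w ≠ u := fun h => hw (h ▸ hu)
  have h2 : w ≠ v := fun h => hw (h ▸ hv)
  simp [h1, h2, h u hu v hv w hw]

theorem IsPrimeGraph.compl (h : G.IsPrimeGraph) : Gᶜ.IsPrimeGraph := fun X hX =>
  h X (by simpa using hX.compl)

theorem IsModule.union {X Y : Set V} (hX : G.IsModule X) (hY : G.IsModule Y)
    (h : (X ∩ Y).Nonempty) : G.IsModule (X ∪ Y) := by
  obtain ⟨z, hzX, hzY⟩ := h
  have key : ∀ u ∈ X ∪ Y, ∀ w ∉ X ∪ Y, G.Adj w u ↔ G.Adj w z := by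
    rintro u (hu | hu) w hw
    · exact hX u hu z hzX w fun h => hw (Or.inl h)
    · exact hY u hu z hzY w fun h => hw (Or.inr h)
  exact fun u hu v hv w hw => (key u hu w hw).trans (key v hv w hw).symm

/-- Two overlapping proper modules covering all vertices would leave all or none of the edges
across a cut. -/
theorem IsModule.union_ne_univ (hG : G.CutConnected) (hG' : Gᶜ.CutConnected) {X Y : Set V}
    (hX : G.IsModule X) (hY : G.IsModule Y) (hX' : X ≠ Set.univ) (hY' : Y ≠ Set.univ)
    (h : (X ∩ Y).Nonempty) : X ∪ Y ≠ Set.univ := by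
  intro hU
  obtain ⟨z, hzX, hzY⟩ := h
  have hYc : Yᶜ.Nonempty := Set.nonempty_compl.2 hY'
  obtain ⟨w, hw⟩ := Set.nonempty_compl.2 hX'
  have hmem : ∀ v, v ∈ X ∨ v ∈ Y := fun v => by
    have : v ∈ X ∪ Y := hU ▸ Set.mem_univ v
    exact this
  have hwY : w ∈ Y := (hmem w).resolve_left hw
  obtain ⟨y, hy, x, hx, hyx⟩ := hG Y ⟨z, hzY⟩ hYc
  obtain ⟨y', hy', x', hx', hyx'⟩ := hG' Y ⟨z, hzY⟩ hYc
  have hxX := (hmem x).resolve_right hx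
  have hxX' := (hmem x').resolve_right hx'
  have h1 : G.Adj x w := (hY y hy w hwY x hx).1 hyx.symm
  have h2 : ¬ G.Adj x' w := fun h =>
    (compl_adj _ _ _ |>.1 hyx').2 ((hY y' hy' w hwY x' hx').2 h).symm
  exact h2 ((hX x hxX x' hxX' w hw).1 h1.symm).symm

/-- Two vertices are related if some proper module contains both. For a connected graph with
connected complement the classes are the maximal proper modules. -/
def moduleSetoid [Nontrivial V] (hG : G.CutConnected) (hG' : Gᶜ.CutConnected) : Setoid V where
  r u v := ∃ X, G.IsModule X ∧ X ≠ Set.univ ∧ u ∈ X ∧ v ∈ X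
  iseqv := by
    refine ⟨fun v => ⟨{v}, ?_, ?_, rfl, rfl⟩, ?_, ?_⟩
    · rintro _ rfl _ rfl w _; rfl
    · obtain ⟨w, hw⟩ := exists_ne v
      exact fun h => hw (h ▸ Set.mem_univ w : w ∈ ({v} : Set V))
    · rintro u v ⟨X, hX, hX', hu, hv⟩
      exact ⟨X, hX, hX', hv, hu⟩
    · rintro u v w ⟨X, hX, hX', hu, hv⟩ ⟨Y, hY, hY', hv', hw⟩
      exact ⟨X ∪ Y, hX.union hY ⟨v, hv, hv'⟩,
        hX.union_ne_univ hG hG' hY hX' hY' ⟨v, hv, hv'⟩, Or.inl hu, Or.inr hw⟩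

variable (G) in
/-- `π` exhibits `H` as a quotient of `G` by modules, and `ρ` chooses a vertex in each of them. -/
structure IsModuleQuotient {Q : Type*} (H : SimpleGraph Q) (π : V → Q) (ρ : Q → V) : Prop where
  proj_rep : ∀ q, π (ρ q) = q
  adj_iff : ∀ u v, π u ≠ π v → (G.Adj u v ↔ H.Adj (π u) (π v))
  /-- the fibres are the maximal proper modules -/
  proj_eq : ∀ X, G.IsModule X → X ≠ Set.univ → ∀ u ∈ X, ∀ v ∈ X, π u = π v

theorem IsModuleQuotient.adj_rep {Q : Type*} {H : SimpleGraph Q} {π : V → Q} {ρ : Q → V}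
    (h : G.IsModuleQuotient H π ρ) (p q : Q) : G.Adj (ρ p) (ρ q) ↔ H.Adj p q := by
  by_cases hpq : p = q
  · simp [hpq]
  · rw [h.adj_iff _ _ (by rwa [h.proj_rep, h.proj_rep]), h.proj_rep, h.proj_rep]

theorem IsModuleQuotient.isLaden {Q : Type*} {H : SimpleGraph Q} {π : V → Q} {ρ : Q → V}
    (h : G.IsModuleQuotient H π ρ) (hG : G.IsLaden) : H.IsLaden :=
  hG.of_embedding (f := ⟨⟨ρ, Function.LeftInverse.injective h.proj_rep⟩, h.adj_rep _ _⟩)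

/-- Gallai: a connected graph with connected complement has a prime quotient. -/
theorem exists_prime_quotient.{u} {V : Type u} {G : SimpleGraph V} [Finite V] [Nontrivial V]
    (hG : G.CutConnected) (hG' : Gᶜ.CutConnected) :
    ∃ (Q : Type u) (_ : Finite Q) (H : SimpleGraph Q) (π : V → Q) (ρ : Q → V),
      G.IsModuleQuotient H π ρ ∧ H.IsPrimeGraph ∧ ∀ x y : Q, ∃ z, z ≠ x ∧ z ≠ y := by
  let s : Setoid V := moduleSetoid hG hG'
  have hrel : ∀ u v : V, (Quotient.mk s u = Quotient.mk s v) ↔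
      ∃ X, G.IsModule X ∧ X ≠ Set.univ ∧ u ∈ X ∧ v ∈ X := fun u v => Quotient.eq
  have hadj : ∀ u u' w : V, Quotient.mk s u = Quotient.mk s u' →
      Quotient.mk s w ≠ Quotient.mk s u → (G.Adj w u ↔ G.Adj w u') := by
    intro u u' w h hw
    obtain ⟨X, hX, hX', hu, hu'⟩ := (hrel u u').1 h
    exact hX u hu u' hu' w fun hwX => hw ((hrel w u).2 ⟨X, hX, hX', hwX, hu⟩)
  let H : SimpleGraph (Quotient s) := G.comap Quotient.out
  have hout : ∀ q : Quotient s, Quotient.mk s q.out = q := fun q => Quotient.out_eq q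
  have hH : ∀ u v, Quotient.mk s u ≠ Quotient.mk s v →
      (G.Adj u v ↔ H.Adj (Quotient.mk s u) (Quotient.mk s v)) := by
    intro u v huv
    change _ ↔ G.Adj (Quotient.mk s u).out (Quotient.mk s v).out
    rw [hadj v (Quotient.mk s v).out u (hout _).symm huv, G.adj_comm,
      hadj u (Quotient.mk s u).out (Quotient.mk s v).out (hout _).symm
        (by rw [hout]; exact huv.symm), G.adj_comm]
  refine ⟨Quotient s, inferInstance, H, Quotient.mk s, Quotient.out, ⟨hout, hH, ?_⟩, ?_, ?_⟩
  · exact fun X hX hX' u hu v hv => (hrel u v).2 ⟨X, hX, hX', hu, hv⟩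
  · rintro X hX ⟨x, hx, y, hy, hxy⟩
    by_contra hXu
    have hP : G.IsModule {v | Quotient.mk s v ∈ X} := by
      intro u hu v hv w hw
      have h1 : Quotient.mk s w ≠ Quotient.mk s u := fun h => hw (by simpa [h] using hu)
      have h2 : Quotient.mk s w ≠ Quotient.mk s v := fun h => hw (by simpa [h] using hv)
      rw [hH w u h1, hH w v h2]
      exact hX _ hu _ hv _ hw
    have hP' : {v | Quotient.mk s v ∈ X} ≠ Set.univ := by
      intro h
      refine hXu (Set.eq_univ_of_forall fun q => ?_)
      have : q.out ∈ {v | Quotient.mk s v ∈ X} := h ▸ Set.mem_univ _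
      simpa [hout] using this
    have := (hrel x.out y.out).2 ⟨_, hP, hP', by simpa [hout], by simpa [hout]⟩
    rw [hout, hout] at this
    exact hxy this
  · intro x y
    by_contra! hxy
    -- The fibre of `x` is a proper subset: a maximal proper module through a vertex of it would
    -- otherwise absorb every vertex.
    have hne : ∃ v, Quotient.mk s v ≠ x := by
      by_contra! hall
      obtain ⟨M, hM⟩ := (Set.toFinite {M : Set V | G.IsModule M ∧ M ≠ Set.univ ∧
        x.out ∈ M}).exists_maximal (by
          obtain ⟨X, h1, h2, h3, -⟩ := (hrel x.out x.out).1 rfl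
          exact ⟨X, h1, h2, h3⟩)
      obtain ⟨⟨hM1, hM2, hM3⟩, hmax⟩ := hM
      obtain ⟨v, hv⟩ := Set.nonempty_compl.2 hM2
      obtain ⟨X, hX, hX', hu, hvX⟩ := (hrel x.out v).1 (by rw [hall, hall])
      refine hv (hmax ⟨hM1.union hX ⟨x.out, hM3, hu⟩,
        hM1.union_ne_univ hG hG' hX hM2 hX' ⟨x.out, hM3, hu⟩, Or.inl hM3⟩
        Set.subset_union_left (Or.inr hvX))
    -- with at most two fibres all or none of the edges between them would be present
    obtain ⟨v, hv⟩ := hne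
    have hA : ({v | Quotient.mk s v = x} : Set V).Nonempty := ⟨x.out, hout x⟩
    have hB : ({v | Quotient.mk s v = x} : Set V)ᶜ.Nonempty := ⟨v, hv⟩
    obtain ⟨a, ha, b, hb, hab⟩ := hG _ hA hB
    obtain ⟨a', ha', b', hb', hab'⟩ := hG' _ hA hB
    have ea : Quotient.mk s a = Quotient.mk s a' := Eq.trans ha (Eq.symm ha')
    have eb : Quotient.mk s b = Quotient.mk s b' := (hxy _ hb).trans (hxy _ hb').symm
    have hab_ne : Quotient.mk s a ≠ Quotient.mk s b := fun h => hb (h.symm.trans ha)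
    rw [hH a b hab_ne, ea, eb, ← hH a' b' (by rwa [← ea, ← eb])] at hab
    exact ((compl_adj _ _ _).1 hab').2 hab

/-- In a prime graph with at least three vertices no vertex sees all others uniformly. -/
theorem IsPrimeGraph.exists_adj_not_adj (h : G.IsPrimeGraph)
    (h3 : ∀ x y : V, ∃ z, z ≠ x ∧ z ≠ y) (v : V) :
    (∃ u, u ≠ v ∧ G.Adj v u) ∧ ∃ u, u ≠ v ∧ ¬ G.Adj v u := by
  have key : ¬ G.IsModule {v}ᶜ := by
    intro hm
    obtain ⟨x, hx, -⟩ := h3 v v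
    obtain ⟨y, hy, hyx⟩ := h3 v x
    have := h _ hm ⟨x, hx, y, hy, hyx.symm⟩
    exact (this ▸ Set.mem_univ v : v ∈ ({v}ᶜ : Set V)) rfl
  constructor <;> by_contra! hc <;> refine key fun a ha b hb w hw => ?_ <;>
    rw [show w = v from not_not.1 hw]
  · simp [hc a ha, hc b hb]
  · simp [hc a ha, hc b hb]

end Modules

/-! ### The house, its complement and the five-cycle -/

section FiveVertices

/-- The house: the cycle `0 1 2 3` with a roof `4` over the edge `03`. -/
def houseTable : Fin 5 → Fin 5 → Bool :=
  ![![false, true, false, true, true],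
    ![true, false, true, false, false],
    ![false, true, false, true, false],
    ![true, false, true, false, true],
    ![true, false, false, true, false]]

/-- The complement of `houseTable`, a path on five vertices. -/
def coHouseTable : Fin 5 → Fin 5 → Bool :=
  ![![false, false, true, false, false],
    ![false, false, false, true, true],
    ![true, false, false, false, true],
    ![false, true, false, false, false],
    ![false, true, true, false, false]]

/-- The cycle on five vertices. -/
def c5Table : Fin 5 → Fin 5 → Bool :=
  ![![false, true, false, false, true],
    ![true, false, true, false, false],
    ![false, true, false, true, false],
    ![false, false, true, false, true],
    ![true, false, false, true, false]]

/-- The 4-cycle `0 1 2 3` with pendant vertices at `0` and `1`, joined to each other if `b`. -/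
def pendantTable (b : Bool) : Fin 6 → Fin 6 → Bool :=
  ![![false, true, false, true, true, false],
    ![true, false, true, false, false, true],
    ![false, true, false, true, false, false],
    ![true, false, true, false, false, false],
    ![true, false, false, false, false, b],
    ![false, true, false, false, b, false]]

variable {V : Type*} {G : SimpleGraph V}

/-- With a sixth vertex that sees only some of its vertices, a house has three `P₄`'s and a `2K₂` or
a `C₄`. -/
theorem IsLaden.uniform_house (hG : G.IsLaden) {f : Fin 5 → V}
    (hf : ∀ i j, G.Adj (f i) (f j) ↔ houseTable i j = true) {v : V} (hv : v ∉ Set.range f)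
    (i j : Fin 5) : G.Adj v (f i) ↔ G.Adj v (f j) :=
  hG.uniform_of_five hf (by decide) (by decide +kernel) hv i j

theorem IsLaden.uniform_coHouse (hG : G.IsLaden) {f : Fin 5 → V}
    (hf : ∀ i j, G.Adj (f i) (f j) ↔ coHouseTable i j = true) {v : V} (hv : v ∉ Set.range f)
    (i j : Fin 5) : G.Adj v (f i) ↔ G.Adj v (f j) :=
  hG.uniform_of_five hf (by decide) (by decide +kernel) hv i j

theorem IsLaden.uniform_c5 (hG : G.IsLaden) {f : Fin 5 → V}
    (hf : ∀ i j, G.Adj (f i) (f j) ↔ c5Table i j = true) {v : V} (hv : v ∉ Set.range f)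
    (i j : Fin 5) : G.Adj v (f i) ↔ G.Adj v (f j) :=
  hG.uniform_of_five hf (by decide) (by decide +kernel) hv i j

theorem IsLaden.false_of_pendant (hG : G.IsLaden) {f : Fin 6 → V} {b : Bool}
    (hf : ∀ i j, G.Adj (f i) (f j) ↔ pendantTable b i j = true) : False := by
  refine hG.false_of_six (injective_of_rows hf ?_) hf ?_
  · clear hf; revert b; decide
  · clear hf; revert b; decide +kernel

/-- A laden graph has no three vertices in the second place of a `P₄`, two of which are not
adjacent. This bounds the fibres over the middle vertices of a `P₄` in the prime quotient. -/
theorem IsLaden.false_of_three_mids (hG : G.IsLaden) {x y z s j t : V} (hx : G.IsP4 s x j t)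
    (hy : G.IsP4 s y j t) (hz : G.IsP4 s z j t) (hxy : x ≠ y) (hxz : x ≠ z) (hyz : y ≠ z)
    (hadj : ¬ G.Adj x y) : False := by
  classical
  obtain ⟨x1, x2, x3, x4, x5, x6⟩ := hx
  obtain ⟨y1, y2, -, -, y5, -⟩ := hy
  obtain ⟨z1, z2, -, -, z5, -⟩ := hz
  have n1 : s ≠ j := by rintro rfl; exact x6 x3
  have n2 : s ≠ t := by rintro rfl; exact x5 x1.symm
  have n3 : x ≠ t := by rintro rfl; exact x6 x1
  have n4 : y ≠ t := by rintro rfl; exact x6 y1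
  have n5 : z ≠ t := by rintro rfl; exact x6 z1
  have hinj : Function.Injective ![x, y, z, s, j, t] := by
    intro i k
    fin_cases i <;> fin_cases k <;>
      simp [hxy, hxz, hyz, hxy.symm, hxz.symm, hyz.symm, n1, n2, n3, n4, n5, n1.symm, n2.symm,
        n3.symm, n4.symm, n5.symm, x1.ne, x1.ne.symm, y1.ne, y1.ne.symm, z1.ne, z1.ne.symm,
        x2.ne, x2.ne.symm, y2.ne, y2.ne.symm, z2.ne, z2.ne.symm, x3.ne, x3.ne.symm]
  set p := decide (G.Adj x z) with hp
  set q := decide (G.Adj y z) with hq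
  let A : Bool → Bool → Fin 6 → Fin 6 → Bool := fun p q =>
    ![![false, false, p, true, true, false],
      ![false, false, q, true, true, false],
      ![p, q, false, true, true, false],
      ![true, true, true, false, false, false],
      ![true, true, true, false, false, true],
      ![false, false, false, false, true, false]]
  have hA : ∀ i k, G.Adj (![x, y, z, s, j, t] i) (![x, y, z, s, j, t] k) ↔ A p q i k = true := by
    refine adj_iff_of_lt ?_ ?_ ?_
    · intro i; fin_cases i <;> rfl
    · intro i k; fin_cases i <;> fin_cases k <;> rfl
    · intro i k hik
      fin_cases i <;> fin_cases k <;> first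
        | exact absurd hik (by decide)
        | simp [A, hp, hq, hadj, x1.symm, x2, x3, x4, x5, x6, y1.symm, y2, y5, z1.symm, z2, z5]
  have hA' : ∀ p q, boolNotLaden (A p q) = true := by
    simp only [A]; decide +kernel
  exact hG.false_of_six hinj hA (hA' p q)

end FiveVertices

/-! ### Four-cycles in prime laden graphs -/

section Prime

variable {V : Type*} {G : SimpleGraph V}

/-- Connectedness of the complement of `G` on the set `A`, in terms of cuts. -/
def IsAnticonnected (G : SimpleGraph V) (A : Set V) : Prop :=
  ∀ p : V → Prop, (∃ x ∈ A, p x) → (∃ x ∈ A, ¬ p x) →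
    ∃ x ∈ A, ∃ y ∈ A, p x ∧ ¬ p y ∧ ¬ G.Adj x y

/-- A pair of anticonnected sets, completely joined to each other. Such a pair with at least two
vertices on both sides contains a `C₄`. -/
structure IsJoinedPair (G : SimpleGraph V) (A B : Set V) : Prop where
  adj : ∀ x ∈ A, ∀ y ∈ B, G.Adj x y
  anti_left : G.IsAnticonnected A
  anti_right : G.IsAnticonnected B
  nontrivial_left : A.Nontrivial
  nontrivial_right : B.Nontrivial

theorem IsJoinedPair.symm {A B : Set V} (h : G.IsJoinedPair A B) : G.IsJoinedPair B A :=
  ⟨fun x hx y hy => (h.adj y hy x hx).symm, h.anti_right, h.anti_left, h.nontrivial_right,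
    h.nontrivial_left⟩

theorem isAnticonnected_pair {a b : V} (h : ¬ G.Adj a b) : G.IsAnticonnected {a, b} := by
  have h' : ¬ G.Adj b a := fun h'' => h h''.symm
  rintro p ⟨x, hx, hpx⟩ ⟨y, hy, hpy⟩
  refine ⟨x, hx, y, hy, hpx, hpy, ?_⟩
  rcases hx with rfl | rfl <;> rcases hy with rfl | rfl <;> simp_all

theorem IsAnticonnected.insert {A : Set V} (h : G.IsAnticonnected A) {v x : V} (hx : x ∈ A)
    (hvx : ¬ G.Adj v x) : G.IsAnticonnected (insert v A) := by
  have hxv : ¬ G.Adj x v := fun h => hvx h.symm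
  rintro p ⟨y, hy, hpy⟩ ⟨z, hz, hpz⟩
  by_cases h1 : ∃ y ∈ A, p y
  · by_cases h2 : ∃ z ∈ A, ¬ p z
    · obtain ⟨y, hy, z, hz, h⟩ := h p h1 h2
      exact ⟨y, Or.inr hy, z, Or.inr hz, h⟩
    · push Not at h2
      have : z = v := hz.resolve_right fun h => hpz (h2 z h)
      subst this
      exact ⟨x, Or.inr hx, z, Or.inl rfl, h2 x hx, hpz, hxv⟩
  · push Not at h1
    have : y = v := hy.resolve_right fun h => h1 y h hpy
    subst this
    exact ⟨y, Or.inl rfl, x, Or.inr hx, hpy, h1 x hx, hvx⟩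

/-- The left side of a maximal pair is not a module. A vertex that distinguishes two of its
vertices either makes a house or is a pendant vertex to a `C₄`. -/
theorem IsJoinedPair.house_or_pendant (hG : G.IsPrimeGraph) {A B : Set V}
    (h : G.IsJoinedPair A B)
    (hmax : ∀ v x, x ∈ A → ¬ G.Adj v x → (∀ y ∈ B, G.Adj v y) → v ∈ A) :
    (∃ f : Fin 5 → V, ∀ i j, G.Adj (f i) (f j) ↔ houseTable i j = true) ∨
      ∃ v, ∃ x ∈ A, ∃ x' ∈ A, G.Adj v x ∧ ¬ G.Adj v x' ∧ ¬ G.Adj x x' ∧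
        ∀ y ∈ B, ¬ G.Adj v y := by
  have hAm : ¬ G.IsModule A := by
    intro hm
    have := hG A hm h.nontrivial_left
    obtain ⟨y, hy⟩ := h.nontrivial_right.nonempty
    exact G.irrefl (h.adj y (this ▸ Set.mem_univ y) y hy)
  obtain ⟨w, hwA, u, hu, u', hu', hwu, hwu'⟩ :
      ∃ w ∉ A, ∃ u ∈ A, ∃ u' ∈ A, G.Adj w u ∧ ¬ G.Adj w u' := by
    by_contra! hc
    exact hAm fun u hu v hv w hw => ⟨hc w hw u hu v hv, hc w hw v hv u hu⟩
  obtain ⟨x, hx, x', hx', hwx, hwx', hxx'⟩ := h.anti_left (G.Adj w) ⟨u, hu, hwu⟩ ⟨u', hu', hwu'⟩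
  by_cases hB : ∃ y ∈ B, G.Adj w y
  · left
    obtain ⟨y', hy', y, hy, hwy', hwy, hyy'⟩ := h.anti_right (G.Adj w) hB (by
      by_contra! hc
      exact hwA (hmax w x' hx' hwx' hc))
    refine ⟨![x, y, x', y', w], adj_iff_of_lt ?_ ?_ ?_⟩
    · intro i; fin_cases i <;> rfl
    · intro i k; fin_cases i <;> fin_cases k <;> rfl
    · have a1 := h.adj x hx y hy
      have a2 := (h.adj x' hx' y hy).symm
      have a3 := h.adj x' hx' y' hy'
      have a4 := h.adj x hx y' hy'
      have b1 : ¬ G.Adj y y' := fun h => hyy' h.symm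
      have b2 : ¬ G.Adj y w := fun h => hwy h.symm
      have b3 : ¬ G.Adj x' w := fun h => hwx' h.symm
      intro i k hik
      fin_cases i <;> fin_cases k <;> first
        | exact absurd hik (by decide)
        | simp [houseTable, a1, a2, a3, a4, hxx', b1, b2, b3, hwx.symm, hwy'.symm]
  · right
    push Not at hB
    exact ⟨w, x, hx, x', hx', hwx, hwx', hxx', hB⟩

/-- A prime laden graph with a `C₄` contains a house: a maximal joined pair gives either a house
or a pendant vertex at each side, and the second is excluded by `IsLaden.false_of_pendant`. -/
theorem IsPrimeGraph.exists_house [Finite V] (hG : G.IsPrimeGraph) (hl : G.IsLaden)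
    {a b c d : V} (h : G.IsC4 a b c d) :
    ∃ f : Fin 5 → V, ∀ i j, G.Adj (f i) (f j) ↔ houseTable i j = true := by
  obtain ⟨h1, h2, h3, h4, h5, h6, n1, n2⟩ := h
  have hpair : G.IsJoinedPair {a, c} {b, d} := by
    refine ⟨?_, isAnticonnected_pair h5, isAnticonnected_pair h6, Set.nontrivial_pair n1,
      Set.nontrivial_pair n2⟩
    rintro x (rfl | rfl) y (rfl | rfl)
    · exact h1
    · exact h4.symm
    · exact h2.symm
    · exact h3
  obtain ⟨⟨A, B⟩, hAB, hmax⟩ := (Set.toFinite {P : Set V × Set V |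
    G.IsJoinedPair P.1 P.2}).exists_maximal ⟨({a, c}, {b, d}), hpair⟩
  have hAB : G.IsJoinedPair A B := hAB
  have hA : ∀ v x, x ∈ A → ¬ G.Adj v x → (∀ y ∈ B, G.Adj v y) → v ∈ A := by
    intro v x hx hvx hvB
    have : G.IsJoinedPair (insert v A) B := by
      refine ⟨?_, hAB.anti_left.insert hx hvx, hAB.anti_right,
        hAB.nontrivial_left.mono (Set.subset_insert _ _), hAB.nontrivial_right⟩
      rintro u (rfl | hu) y hy
      · exact hvB y hy
      · exact hAB.adj u hu y hy
    exact (hmax (y := (insert v A, B)) this ⟨Set.subset_insert _ _, le_rfl⟩).1 (Or.inl rfl)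
  have hB : ∀ v x, x ∈ B → ¬ G.Adj v x → (∀ y ∈ A, G.Adj v y) → v ∈ B := by
    intro v x hx hvx hvA
    have : G.IsJoinedPair A (insert v B) := by
      refine ⟨?_, hAB.anti_left, hAB.anti_right.insert hx hvx, hAB.nontrivial_left,
        hAB.nontrivial_right.mono (Set.subset_insert _ _)⟩
      rintro u hu y (rfl | hy)
      · exact (hvA u hu).symm
      · exact hAB.adj u hu y hy
    exact (hmax (y := (A, insert v B)) this ⟨le_rfl, Set.subset_insert _ _⟩).2 (Or.inl rfl)
  rcases hAB.house_or_pendant hG hA with hf | ⟨v, x, hx, x', hx', hvx, hvx', hxx', hvB⟩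
  · exact hf
  rcases hAB.symm.house_or_pendant hG hB with hf | ⟨w, y, hy, y', hy', hwy, hwy', hyy', hwA⟩
  · exact hf
  classical
  exfalso
  refine hl.false_of_pendant (f := ![x, y, x', y', v, w]) (b := decide (G.Adj v w))
    (adj_iff_of_lt ?_ ?_ ?_)
  · intro i; fin_cases i <;> rfl
  · intro i k; fin_cases i <;> fin_cases k <;> rfl
  · have a1 := hAB.adj x hx y hy
    have a2 := (hAB.adj x' hx' y hy).symm
    have a3 := hAB.adj x' hx' y' hy'
    have a4 := hAB.adj x hx y' hy'
    have b1 : ¬ G.Adj y v := fun h => hvB y hy h.symm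
    have b2 : ¬ G.Adj y' v := fun h => hvB y' hy' h.symm
    have b3 : ¬ G.Adj x w := fun h => hwA x hx h.symm
    have b4 : ¬ G.Adj x' w := fun h => hwA x' hx' h.symm
    have b5 : ¬ G.Adj x' v := fun h => hvx' h.symm
    have b6 : ¬ G.Adj y' w := fun h => hwy' h.symm
    intro i k hik
    fin_cases i <;> fin_cases k <;> first
      | exact absurd hik (by decide)
      | simp [pendantTable, a1, a2, a3, a4, hxx', hyy', b1, b2, b3, b4, b5, b6, hvx.symm,
          hwy.symm]

end Prime

/-! ### Split graphs -/

section Split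

variable {V : Type*} {G : SimpleGraph V}

/-- Of two adjacent vertices outside a clique, in a graph without `C₄`, one has all the
non-neighbours of the other in the clique. -/
theorem nonneighbors_comparable {K : Set V} (hK : G.IsClique K)
    (hC4 : ∀ a b c d, ¬ G.IsC4 a b c d) {x y : V} (hx : x ∉ K) (hy : y ∉ K) (hxy : G.Adj x y) :
    (∀ u ∈ K, ¬ G.Adj x u → ¬ G.Adj y u) ∨ ∀ u ∈ K, ¬ G.Adj y u → ¬ G.Adj x u := by
  by_contra! h
  obtain ⟨⟨u, hu, hxu, hyu⟩, w, hw, hyw, hxw⟩ := h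
  have huw : u ≠ w := by rintro rfl; exact hxu hxw
  exact hC4 x w u y ⟨hxw, (hK hu hw huw).symm, hyu.symm, hxy.symm, hxu, fun h => hyw h.symm,
    fun h => hx (h ▸ hu), fun h => hy (h ▸ hw)⟩

/-- Földes–Hammer: a graph without induced `2K₂`, `C₄`, `C₅` is split. A maximum clique with the
largest degree sum has an independent complement. -/
theorem exists_split_partition [Finite V] (h2 : ∀ a b c d, ¬ G.IsTwoK2 a b c d)
    (hC4 : ∀ a b c d, ¬ G.IsC4 a b c d)
    (hC5 : ¬ ∃ f : Fin 5 → V, ∀ i j, G.Adj (f i) (f j) ↔ c5Table i j = true) :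
    ∃ K : Set V, G.IsClique K ∧ ∀ x ∉ K, ∀ y ∉ K, ¬ G.Adj x y := by
  classical
  have := Fintype.ofFinite V
  obtain ⟨K, hKm, hmax⟩ := (Finset.univ.filter fun K : Finset V => G.IsClique K).exists_max_image
    (fun K => toLex (K.card, ∑ v ∈ K, G.degree v)) ⟨∅, by simp⟩
  have hK : G.IsClique (K : Set V) := (Finset.mem_filter.1 hKm).2
  have hcard : ∀ L : Finset V, G.IsClique (L : Set V) → L.card ≤ K.card := fun L hL => by
    have := hmax L (by simpa using hL)
    rw [Prod.Lex.toLex_le_toLex] at this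
    rcases this with h | ⟨h, -⟩
    · exact h.le
    · exact h.le
  have hdeg : ∀ L : Finset V, G.IsClique (L : Set V) → L.card = K.card →
      ∑ v ∈ L, G.degree v ≤ ∑ v ∈ K, G.degree v := fun L hL hc => by
    have := hmax L (by simpa using hL)
    rw [Prod.Lex.toLex_le_toLex] at this
    rcases this with h | ⟨-, h⟩
    · exact absurd hc h.ne
    · exact h
  have hnon : ∀ v ∉ K, ∃ u ∈ K, ¬ G.Adj v u := by
    intro v hv
    by_contra! h
    have := hcard (insert v K) (by
      rw [Finset.coe_insert]
      exact hK.insert fun u hu _ => h u hu)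
    rw [Finset.card_insert_of_notMem hv] at this
    omega
  refine ⟨K, hK, ?_⟩
  have main : ∀ x ∉ K, ∀ y ∉ K, G.Adj x y → (∀ u ∈ K, ¬ G.Adj x u → ¬ G.Adj y u) → False := by
    intro x hx y hy hxy hsub
    obtain ⟨u, hu, hxu⟩ := hnon x hx
    have hyu := hsub u hu hxu
    have huniq : ∀ w ∈ K, w ≠ u → G.Adj x w := by
      intro w hw hwu
      by_contra hxw
      exact h2 x y u w ⟨hxy, hK hu hw hwu.symm, hxu, hxw, hyu, hsub w hw hxw⟩
    have hclique : G.IsClique ((insert x (K.erase u) : Finset V) : Set V) := by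
      rw [Finset.coe_insert]
      refine IsClique.insert (hK.subset (by simp)) fun w hw _ => ?_
      have := Finset.mem_erase.1 (Finset.mem_coe.1 hw)
      exact huniq w this.2 this.1
    have hx' : x ∉ K.erase u := fun h => hx (Finset.mem_of_mem_erase h)
    have hcx : (insert x (K.erase u)).card = K.card := by
      rw [Finset.card_insert_of_notMem hx', Finset.card_erase_add_one hu]
    obtain ⟨w, hw, hwu, hyw⟩ : ∃ w ∈ K, w ≠ u ∧ ¬ G.Adj y w := by
      by_contra! h
      have hy' : y ∉ insert x (K.erase u) := by
        simp [hxy.ne.symm, hy]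
      have := hcard (insert y (insert x (K.erase u))) (by
        rw [Finset.coe_insert]
        refine hclique.insert fun w hw _ => ?_
        rcases Finset.mem_insert.1 (Finset.mem_coe.1 hw) with rfl | hw
        · exact hxy.symm
        · exact h w (Finset.mem_of_mem_erase hw) (Finset.ne_of_mem_erase hw))
      rw [Finset.card_insert_of_notMem hy', hcx] at this
      omega
    -- exchanging `u` for `x` does not increase the degree sum
    have hd : G.degree x ≤ G.degree u := by
      have := hdeg _ hclique hcx
      rw [Finset.sum_insert hx', ← Finset.add_sum_erase K _ hu] at this
      omega
    obtain ⟨z, huz, hxz⟩ : ∃ z, G.Adj u z ∧ ¬ G.Adj x z := by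
      by_contra! h
      have : G.neighborFinset u ⊂ G.neighborFinset x := by
        refine Finset.ssubset_iff_subset_ne.2 ⟨fun z hz => ?_, fun h' => ?_⟩
        · rw [mem_neighborFinset] at hz ⊢; exact h z hz
        · have : y ∈ G.neighborFinset x := by simpa using hxy
          rw [← h', mem_neighborFinset] at this
          exact hyu this.symm
      have := Finset.card_lt_card this
      rw [card_neighborFinset_eq_degree, card_neighborFinset_eq_degree] at this
      omega
    have hzK : z ∉ K := fun hz => hxz (huniq z hz huz.ne.symm)
    have hyz : G.Adj y z := by
      by_contra hyz
      exact h2 x y u z ⟨hxy, huz, hxu, hxz, hyu, hyz⟩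
    have hsub' : ∀ w ∈ K, ¬ G.Adj z w → ¬ G.Adj y w := by
      rcases nonneighbors_comparable hK hC4 hy hzK hyz with h | h
      · exact absurd huz.symm (h u hu hyu)
      · exact h
    obtain ⟨w', hw', hzw'⟩ := hnon z hzK
    have hyw' := hsub' w' hw' hzw'
    have hw'u : w' ≠ u := by rintro rfl; exact hzw' huz.symm
    have hxw' := huniq w' hw' hw'u
    refine hC5 ⟨![x, y, z, u, w'], adj_iff_of_lt ?_ ?_ ?_⟩
    · intro i; fin_cases i <;> rfl
    · intro i k; fin_cases i <;> fin_cases k <;> rfl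
    · have a1 := hK hu hw' hw'u.symm
      intro i k hik
      fin_cases i <;> fin_cases k <;> first
        | exact absurd hik (by decide)
        | simp [c5Table, hxy, hyz, huz.symm, a1, hxw', hxz, hxu, hyu, hyw', hzw']
  intro x hx y hy hxy
  have hx' : x ∉ (K : Set V) := hx
  rcases nonneighbors_comparable hK hC4 hx hy hxy with h | h
  · exact main x (by simpa using hx) y (by simpa using hy) hxy h
  · exact main y (by simpa using hy) x (by simpa using hx) hxy.symm h

/-- In a prime split graph, a clique vertex `i` with a neighbour in the independent set lies in
the middle of a `P₄`. Otherwise the neighbourhoods of all clique vertices in the independent set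
are comparable with that of `i`; then `i`, its neighbours in the independent set and the clique
vertices with strictly smaller neighbourhoods form a module. -/
theorem IsPrimeGraph.exists_p4 (hG : G.IsPrimeGraph) (h3 : ∀ x y : V, ∃ z, z ≠ x ∧ z ≠ y)
    {K : Set V} (hK : G.IsClique K) (hS : ∀ x ∉ K, ∀ y ∉ K, ¬ G.Adj x y) {i s : V} (hi : i ∈ K)
    (hs : s ∉ K) (his : G.Adj i s) :
    ∃ s j s', s ∉ K ∧ j ∈ K ∧ s' ∉ K ∧ G.IsP4 s i j s' := by
  by_contra! hno
  have hcomp : ∀ j ∈ K, ∀ t ∉ K, G.Adj i t → ¬ G.Adj j t → ∀ t' ∉ K, G.Adj j t' →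
      G.Adj i t' := by
    intro j hj t ht hit hjt t' ht' hjt'
    by_contra hit'
    have hij : i ≠ j := by rintro rfl; exact hjt hit
    exact hno t j t' ht hj ht' ⟨hit.symm, hK hi hj hij, hjt', fun h => hjt h.symm, hit',
      hS t ht t' ht'⟩
  set Z : Set V := {v | v = i ∨ (v ∈ K ∧ ∃ t ∉ K, G.Adj i t ∧ ¬ G.Adj v t) ∨
    (v ∉ K ∧ G.Adj i v)} with hZ
  have hZm : G.IsModule Z := by
    have key : ∀ w ∉ Z, (w ∈ K ∧ ∀ v ∈ Z, G.Adj w v) ∨ (w ∉ K ∧ ∀ v ∈ Z, ¬ G.Adj w v) := by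
      intro w hw
      simp only [hZ, Set.mem_ofPred_eq, not_or, not_and, not_exists, not_not] at hw
      obtain ⟨hwi, hwK, hwS⟩ := hw
      by_cases hwk : w ∈ K
      · refine Or.inl ⟨hwk, ?_⟩
        rintro v (rfl | ⟨hv, t, ht, hit, hvt⟩ | ⟨hv, hiv⟩)
        · exact hK hwk hi hwi
        · refine hK hwk hv ?_
          rintro rfl
          exact hvt (hwK hwk t ht hit)
        · exact hwK hwk v hv hiv
      · refine Or.inr ⟨hwk, ?_⟩
        rintro v (rfl | ⟨hv, t, ht, hit, hvt⟩ | ⟨hv, hiv⟩) hwv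
        · exact hwS hwk hwv.symm
        · exact hwS hwk (hcomp v hv t ht hit hvt w hwk hwv.symm)
        · exact hS w hwk v hv hwv
    intro u hu v hv w hw
    rcases key w hw with ⟨-, h⟩ | ⟨-, h⟩ <;> simp [h u hu, h v hv]
  have hZu := hG Z hZm ⟨i, Or.inl rfl, s, Or.inr (Or.inr ⟨hs, his⟩), his.ne⟩
  obtain ⟨-, u, hui, hiu⟩ := hG.exists_adj_not_adj h3 i
  have huZ : u ∈ Z := hZu ▸ Set.mem_univ u
  rcases huZ with rfl | ⟨hu, -⟩ | ⟨-, h⟩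
  · exact hui rfl
  · exact hiu (hK hi hu hui.symm)
  · exact hiu h

end Split

/-! ### Connected laden graphs with connected complement -/

section Structure

variable {V : Type*}

/-- A partition of the vertex set as in a spider: the body `K` is a clique up to pairs of false
twins, the legs `S` are independent up to pairs of true twins, and the head `R`, possibly empty,
is complete to `K` and anticomplete to `S`. -/
structure IsSpiderPartition (G : SimpleGraph V) (K S R : Set V) : Prop where
  cover : ∀ v, v ∈ K ∨ v ∈ S ∨ v ∈ R
  disjoint : ∀ v ∈ K, v ∉ S
  adj_of_mem : ∀ k ∈ K, ∀ r ∈ R, G.Adj k r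
  not_adj_of_mem : ∀ s ∈ S, ∀ r ∈ R, ¬ G.Adj s r
  twin_left : ∀ x ∈ K, ∀ y ∈ K, x ≠ y → ¬ G.Adj x y → ∀ z, G.Adj z x ↔ G.Adj z y
  unique_left : ∀ x ∈ K, ∀ y ∈ K, ∀ z ∈ K, x ≠ y → x ≠ z → ¬ G.Adj x y → ¬ G.Adj x z → y = z
  twin_right : ∀ x ∈ S, ∀ y ∈ S, G.Adj x y → ∀ z, z ≠ x → z ≠ y → (G.Adj z x ↔ G.Adj z y)
  unique_right : ∀ x ∈ S, ∀ y ∈ S, ∀ z ∈ S, G.Adj x y → G.Adj x z → y = z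
  exists_adj : ∀ k ∈ K, ∃ s ∈ S, G.Adj k s
  exists_not_adj : ∀ s ∈ S, ∃ k ∈ K, ¬ G.Adj s k
  exists_path : ∃ s i j t, i ∈ K ∧ j ∈ K ∧ G.IsP4 s i j t

variable {G : SimpleGraph V} {Q : Type*} {H : SimpleGraph Q} {π : V → Q} {ρ : Q → V}

theorem IsP4.lift (hq : G.IsModuleQuotient H π ρ) {a b c d : V}
    (h : H.IsP4 (π a) (π b) (π c) (π d)) : G.IsP4 a b c d := by
  obtain ⟨h1, h2, h3, h4, h5, h6⟩ := h
  have n1 : π a ≠ π c := by intro e; rw [e] at h6; exact h6 h3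
  have n2 : π b ≠ π d := by intro e; rw [← e] at h6; exact h6 h1
  have n3 : π a ≠ π d := by intro e; rw [e] at h4; exact h4 h3.symm
  simp only [IsP4, hq.adj_iff _ _ h1.ne, hq.adj_iff _ _ h2.ne, hq.adj_iff _ _ h3.ne,
    hq.adj_iff _ _ n1, hq.adj_iff _ _ n2, hq.adj_iff _ _ n3]
  exact ⟨h1, h2, h3, h4, h5, h6⟩

/-- If a five-vertex graph is seen uniformly from outside in laden graphs, then a copy of it in
the prime quotient makes up all of the graph. -/
theorem IsModuleQuotient.exists_surjective (hq : G.IsModuleQuotient H π ρ)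
    {A : Fin 5 → Fin 5 → Bool}
    (hA : ∀ f : Fin 5 → V, (∀ i j, G.Adj (f i) (f j) ↔ A i j = true) → ∀ v ∉ Set.range f,
      ∀ i j, G.Adj v (f i) ↔ G.Adj v (f j))
    (hr : ∀ i j, (∀ k, A i k = A j k) → i = j)
    (h : ∃ f : Fin 5 → Q, ∀ i j, H.Adj (f i) (f j) ↔ A i j = true) :
    ∃ f : Fin 5 → V, Function.Bijective f ∧ ∀ i j, G.Adj (f i) (f j) ↔ A i j = true := by
  obtain ⟨f, hf⟩ := h
  have hf' : ∀ i j, G.Adj ((ρ ∘ f) i) ((ρ ∘ f) j) ↔ A i j = true := fun i j =>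
    (hq.adj_rep _ _).trans (hf i j)
  refine ⟨ρ ∘ f, ⟨injective_of_rows hf' hr, ?_⟩, hf'⟩
  rw [← Set.range_eq_univ]
  by_contra hne
  have hm : G.IsModule (Set.range (ρ ∘ f)) := by
    rintro _ ⟨i, rfl⟩ _ ⟨j, rfl⟩ w hw
    exact hA _ hf' w hw i j
  have := hq.proj_eq _ hm hne _ ⟨0, rfl⟩ _ ⟨1, rfl⟩
  simp only [Function.comp_apply, hq.proj_rep] at this
  exact absurd (injective_of_rows hf hr this) (by decide)

/-- When the prime quotient is split, with clique `K`, the fibres over the clique vertices with a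
neighbour outside `K` form the body and those over the independent vertices with a non-neighbour
in `K` form the legs; at most one vertex of the quotient remains, and its fibre is the head. -/
theorem IsModuleQuotient.exists_spiderPartition [Nonempty V] (hq : G.IsModuleQuotient H π ρ)
    (hl : G.IsLaden) (hH : H.IsPrimeGraph) (h3 : ∀ x y : Q, ∃ z, z ≠ x ∧ z ≠ y) {K : Set Q}
    (hK : H.IsClique K) (hS : ∀ x ∉ K, ∀ y ∉ K, ¬ H.Adj x y) :
    ∃ K S R : Set V, G.IsSpiderPartition K S R := by
  set K' : Set Q := {i | i ∈ K ∧ ∃ s ∉ K, H.Adj i s} with hK'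
  set S' : Set Q := {s | s ∉ K ∧ ∃ i ∈ K, ¬ H.Adj s i} with hS'
  have hpK : ∀ i ∈ K', ∃ s ∈ S', ∃ j ∈ K', ∃ t ∈ S', H.IsP4 s i j t := by
    rintro i ⟨hi, s, hs, his⟩
    obtain ⟨s, j, t, hs, hj, ht, h⟩ := hH.exists_p4 h3 hK hS hi hs his
    exact ⟨s, ⟨hs, j, hj, h.2.2.2.1⟩, j, ⟨hj, t, ht, h.2.2.1⟩, t,
      ⟨ht, i, hi, fun h' => h.2.2.2.2.1 h'.symm⟩, h⟩
  -- the corresponding fact for `S'` holds in the complement, where `K` and `S` change places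
  have hpS : ∀ s ∈ S', ∃ i ∈ K', ∃ j ∈ K', ∃ t ∈ S', H.IsP4 s i j t := by
    rintro s ⟨hs, i, hi, hsi⟩
    have hK2 : Hᶜ.IsClique Kᶜ := fun x hx y hy hxy => ⟨hxy, hS x hx y hy⟩
    have hS2 : ∀ x ∉ Kᶜ, ∀ y ∉ Kᶜ, ¬ Hᶜ.Adj x y := fun x hx y hy hxy =>
      (compl_adj _ _ _ |>.1 hxy).2
        (hK (not_not.1 hx) (not_not.1 hy) (compl_adj _ _ _ |>.1 hxy).1)
    have hne : s ≠ i := fun h => hs (h ▸ hi)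
    obtain ⟨a, b, c, ha, hb, hc, h⟩ := hH.compl.exists_p4 h3 hK2 hS2 (i := s) (s := i) hs
      (by simpa using hi) (by rw [compl_adj]; exact ⟨hne, hsi⟩)
    have h' := h.compl
    have ha' : a ∈ K := not_not.1 ha
    have hc' : c ∈ K := not_not.1 hc
    exact ⟨c, ⟨hc', s, hs, h'.1.symm⟩, a, ⟨ha', b, hb, h'.2.2.1⟩, b,
      ⟨hb, c, hc', fun h => h'.2.2.2.2.1 h.symm⟩, h'⟩
  have hdisj : ∀ v ∈ K', v ∉ S' := fun v hv hv' => hv'.1 hv.1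
  have hmid : ∀ x y z : V, π x ∈ K' → π y = π x → π z = π x → x ≠ y → ¬ G.Adj x y →
      z = x ∨ z = y := by
    intro x y z hx hy hz hxy hadj
    by_contra! hne
    obtain ⟨s, -, j, -, t, -, h⟩ := hpK _ hx
    have key : ∀ v, π v = π x → G.IsP4 (ρ s) v (ρ j) (ρ t) := fun v hv =>
      IsP4.lift hq (by simpa only [hq.proj_rep, hv] using h)
    exact hl.false_of_three_mids (key x rfl) (key y hy) (key z hz) hxy hne.1.symm hne.2.symm hadj
  have hend : ∀ x y z : V, π x ∈ S' → π y = π x → π z = π x → G.Adj x y →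
      z = x ∨ z = y := by
    intro x y z hx hy hz hadj
    by_contra! hne
    obtain ⟨i, -, j, -, t, -, h⟩ := hpS _ hx
    have key : ∀ v, π v = π x → Gᶜ.IsP4 (ρ i) (ρ t) v (ρ j) := fun v hv =>
      (IsP4.lift (a := v) (b := ρ i) (c := ρ j) (d := ρ t) hq
        (by simpa only [hq.proj_rep, hv] using h)).to_compl
    have key' : ∀ v, π v = π x → Gᶜ.IsP4 (ρ j) v (ρ t) (ρ i) := fun v hv => by
      obtain ⟨h1, h2, h3, h4, h5, h6⟩ := key v hv
      exact ⟨h3.symm, h2.symm, h1.symm, fun h => h5 h.symm, fun h => h4 h.symm,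
        fun h => h6 h.symm⟩
    exact hl.compl.false_of_three_mids (key' x rfl) (key' y hy) (key' z hz) hadj.ne hne.1.symm
      hne.2.symm (by simp [hadj])
  have hfibK : ∀ x y, π x ∈ K' → π y ∈ K' → ¬ G.Adj x y → π y = π x := by
    intro x y hx hy hxy
    by_contra hne
    exact hxy ((hq.adj_iff _ _ (Ne.symm hne)).2 (hK hx.1 hy.1 (Ne.symm hne)))
  have hfibS : ∀ x y, π x ∈ S' → π y ∈ S' → G.Adj x y → π y = π x := by
    intro x y hx hy hxy
    by_contra hne
    exact hS _ hx.1 _ hy.1 ((hq.adj_iff _ _ (Ne.symm hne)).1 hxy)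
  have hrep : ∀ v q, π v ≠ q → (G.Adj v (ρ q) ↔ H.Adj (π v) q) := fun v q hne => by
    rw [hq.adj_iff _ _ (by rwa [hq.proj_rep]), hq.proj_rep]
  refine ⟨π ⁻¹' K', π ⁻¹' S', {v | π v ∉ K' ∧ π v ∉ S'}, ?_, ?_, ?_, ?_, ?_, ?_, ?_, ?_, ?_, ?_,
    ?_⟩
  · intro v
    by_cases h1 : π v ∈ K'
    · exact Or.inl h1
    · by_cases h2 : π v ∈ S'
      · exact Or.inr (Or.inl h2)
      · exact Or.inr (Or.inr ⟨h1, h2⟩)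
  · exact fun v hv => hdisj _ hv
  · rintro k hk r ⟨hrK, hrS⟩
    have hne : π k ≠ π r := fun h => hrK (h ▸ hk)
    rw [hq.adj_iff _ _ hne]
    by_cases hr : π r ∈ K
    · exact hK hk.1 hr hne
    · by_contra hadj
      exact hrS ⟨hr, π k, hk.1, fun h => hadj h.symm⟩
  · rintro s hs r ⟨hrK, hrS⟩ hadj
    have hne : π s ≠ π r := fun h => hrS (h ▸ hs)
    rw [hq.adj_iff _ _ hne] at hadj
    by_cases hr : π r ∈ K
    · exact hrK ⟨hr, π s, hs.1, hadj.symm⟩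
    · exact hS _ hs.1 _ hr hadj
  · intro x hx y hy hxy hadj z
    have hfib := hfibK x y hx hy hadj
    by_cases hz : π z = π x
    · rcases hmid x y z hx hfib hz hxy hadj with rfl | rfl
      · simp [hadj]
      · simpa using fun h : G.Adj z x => hadj h.symm
    · rw [hq.adj_iff _ _ hz, hq.adj_iff z y (by rwa [hfib]), hfib]
  · intro x hx y hy z hz hxy hxz h1 h2
    rcases hmid x y z hx (hfibK x y hx hy h1) (hfibK x z hx hz h2) hxy h1 with rfl | rfl
    · exact absurd rfl hxz
    · rfl
  · intro x hx y hy hadj z hzx hzy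
    have hfib := hfibS x y hx hy hadj
    have hz : π z ≠ π x := fun hz => (hend x y z hx hfib hz hadj).elim hzx hzy
    rw [hq.adj_iff _ _ hz, hq.adj_iff z y (by rwa [hfib]), hfib]
  · intro x hx y hy z hz h1 h2
    rcases hend x y z hx (hfibS x y hx hy h1) (hfibS x z hx hz h2) h1 with rfl | rfl
    · exact absurd h2 (G.irrefl)
    · rfl
  · intro k hk
    obtain ⟨s, hs, j, hj, t, ht, h⟩ := hpK _ hk
    refine ⟨ρ s, by simpa [hq.proj_rep], (hrep k s ?_).2 h.1.symm⟩
    exact fun e => hdisj _ hk (e ▸ hs)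
  · intro s hs
    obtain ⟨i, hi, j, hj, t, ht, h⟩ := hpS _ hs
    refine ⟨ρ j, by simpa [hq.proj_rep], fun h' => h.2.2.2.1 ((hrep s j ?_).1 h')⟩
    exact fun e => hdisj _ hj (e ▸ hs)
  · -- a vertex with a neighbour on the other side exists, since no vertex is isolated
    obtain ⟨i, hi⟩ : ∃ i, i ∈ K' := by
      obtain ⟨v⟩ := ‹Nonempty V›
      by_cases hqK : π v ∈ K
      · obtain ⟨-, u, huq, hqu⟩ := hH.exists_adj_not_adj h3 (π v)
        have huK : u ∉ K := fun h => hqu (hK hqK h huq.symm)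
        obtain ⟨⟨w, hwu, huw⟩, -⟩ := hH.exists_adj_not_adj h3 u
        have hwK : w ∈ K := by_contra fun h => hS u huK w h huw
        exact ⟨w, hwK, u, huK, huw.symm⟩
      · obtain ⟨⟨w, hwu, huw⟩, -⟩ := hH.exists_adj_not_adj h3 (π v)
        have hwK : w ∈ K := by_contra fun h => hS _ hqK w h huw
        exact ⟨w, hwK, _, hqK, huw.symm⟩
    obtain ⟨s, hs, j, hj, t, ht, h⟩ := hpK i hi
    exact ⟨ρ s, ρ i, ρ j, ρ t, by simpa [hq.proj_rep], by simpa [hq.proj_rep],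
      IsP4.lift hq (by simpa only [hq.proj_rep] using h)⟩

/-- The structure of connected laden graphs with connected complement. -/
theorem IsLaden.exists_spiderPartition_or [Finite V] [Nontrivial V] (hl : G.IsLaden)
    (hG : G.CutConnected) (hG' : Gᶜ.CutConnected) :
    (∃ K S R : Set V, G.IsSpiderPartition K S R) ∨
      ∃ A, (A = houseTable ∨ A = coHouseTable ∨ A = c5Table) ∧
        ∃ f : Fin 5 → V, Function.Bijective f ∧ ∀ i j, G.Adj (f i) (f j) ↔ A i j = true := by
  obtain ⟨Q, hQ, H, π, ρ, hq, hH, h3⟩ := exists_prime_quotient hG hG'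
  have hlH : H.IsLaden := hq.isLaden hl
  by_cases hC4 : ∃ a b c d, H.IsC4 a b c d
  · obtain ⟨a, b, c, d, h⟩ := hC4
    exact Or.inr ⟨_, Or.inl rfl, hq.exists_surjective (fun f hf v hv => hl.uniform_house hf hv)
      (by decide) (hH.exists_house hlH h)⟩
  by_cases h2 : ∃ a b c d, H.IsTwoK2 a b c d
  · obtain ⟨a, b, c, d, h⟩ := h2
    have h' : Hᶜ.IsC4 a c b d := IsTwoK2.compl (by rwa [compl_compl])
    obtain ⟨f, hf⟩ := hH.compl.exists_house hlH.compl h'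
    have hinj := injective_of_rows hf (by decide)
    refine Or.inr ⟨_, Or.inr (Or.inl rfl), hq.exists_surjective
      (fun f hf v hv => hl.uniform_coHouse hf hv) (by decide) ⟨f, ?_⟩⟩
    have htab : ∀ i j, i ≠ j → coHouseTable i j = !houseTable i j := by decide
    intro i j
    by_cases hij : i = j
    · subst hij
      have : ∀ i, coHouseTable i i = false := by decide
      simp [this]
    · have h1 := hf i j
      rw [compl_adj] at h1
      simp only [ne_eq, hinj.eq_iff, hij, not_false_eq_true, true_and] at h1
      rw [htab i j hij, Bool.not_eq_true', ← Bool.not_eq_true, ← h1, not_not]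
  by_cases hC5 : ∃ f : Fin 5 → Q, ∀ i j, H.Adj (f i) (f j) ↔ c5Table i j = true
  · exact Or.inr ⟨_, Or.inr (Or.inr rfl), hq.exists_surjective
      (fun f hf v hv => hl.uniform_c5 hf hv) (by decide) hC5⟩
  push Not at hC4 h2
  obtain ⟨K, hK, hS⟩ := exists_split_partition h2 hC4 hC5
  exact Or.inl (hq.exists_spiderPartition hl hH h3 hK hS)

end Structure

/-! ### Counting vertices of large degree -/

section LargeDegrees

variable {V : Type*} [Fintype V] [DecidableEq V] {G : SimpleGraph V} [DecidableRel G.Adj]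

/-- Apart from `i` and `i'`, all neighbours of `w` are neighbours of `i`, and `p`, `q` make up for
these two. -/
theorem degree_le_degree_of_swap {w i i' p q : V}
    (hN : ∀ v, G.Adj w v → v ≠ i → v ≠ i' → G.Adj i v) (hp : G.Adj i p) (hq : G.Adj i q)
    (hpq : p ≠ q) (hwp : ¬ G.Adj w p) (hwq : ¬ G.Adj w q) : G.degree w ≤ G.degree i := by
  have hsub : G.neighborFinset w ⊆ (G.neighborFinset i \ {p, q}) ∪ {i, i'} := by
    intro v hv
    rw [mem_neighborFinset] at hv
    simp only [Finset.mem_union, Finset.mem_sdiff, mem_neighborFinset, Finset.mem_insert,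
      Finset.mem_singleton]
    by_cases h1 : v = i
    · exact Or.inr (Or.inl h1)
    by_cases h2 : v = i'
    · exact Or.inr (Or.inr h2)
    refine Or.inl ⟨hN v hv h1 h2, ?_⟩
    rintro (rfl | rfl)
    exacts [hwp hv, hwq hv]
  have h1 := (Finset.card_le_card hsub).trans (Finset.card_union_le _ _)
  have h2 : ({p, q} : Finset V) ⊆ G.neighborFinset i := by
    intro v hv
    rcases Finset.mem_insert.1 hv with rfl | hv
    · simpa
    · rw [Finset.mem_singleton.1 hv]; simpa
  have h3 := Finset.card_le_card h2
  rw [Finset.card_sdiff_of_subset h2, Finset.card_pair hpq] at h1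
  rw [Finset.card_pair hpq] at h3
  have h4 : ({i, i'} : Finset V).card ≤ 2 := Finset.card_le_two
  simp only [card_neighborFinset_eq_degree] at h1 h3
  omega

/-- Counting: one vertex has degree at least the average `a` but at most `n - 2`, all others have
degree below `a`, and below `a - 1` unless they are counted here. -/
theorem four_lt_card_of_not_hasTwoAbove [Nonempty V] (h2 : 2 < G.averageDegree)
    (hn : ¬ G.HasTwoAbove G.averageDegree) (hG : ∀ v, ∃ u, u ≠ v ∧ ¬ G.Adj v u) :
    4 < (Finset.univ.filter fun v => G.averageDegree ≤ G.degree v + 1).card := by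
  set a := G.averageDegree with ha
  obtain ⟨c, hc⟩ := G.exists_averageDegree_le_degree
  rw [← ha] at hc
  have hlt : ∀ v, v ≠ c → (G.degree v : ℝ) < a := fun v hv => by
    by_contra! h
    exact hn (hasTwoAbove_of_degree hv h2 h hc)
  have hdc : (G.degree c : ℝ) ≤ Fintype.card V - 2 := by
    obtain ⟨u, hu, hcu⟩ := hG c
    have hsub : G.neighborFinset c ⊆ Finset.univ \ {c, u} := by
      intro v hv
      rw [mem_neighborFinset] at hv
      simp only [Finset.mem_sdiff, Finset.mem_univ, Finset.mem_insert, Finset.mem_singleton,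
        true_and]
      rintro (rfl | rfl)
      exacts [G.loopless.irrefl _ hv, hcu hv]
    have h1 := Finset.card_le_card hsub
    have h3 := Finset.card_le_card (Finset.subset_univ ({c, u} : Finset V))
    rw [Finset.card_sdiff_of_subset (Finset.subset_univ _), Finset.card_pair hu.symm,
      card_neighborFinset_eq_degree, Finset.card_univ] at h1
    rw [Finset.card_pair hu.symm, Finset.card_univ] at h3
    have : G.degree c + 2 ≤ Fintype.card V := by omega
    have : (G.degree c : ℝ) + 2 ≤ Fintype.card V := by exact_mod_cast this
    linarith
  have hbound : ∀ v, (G.degree v : ℝ) ≤ (a - 1) + (if a ≤ G.degree v + 1 then 1 else 0) +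
      (if v = c then (Fintype.card V : ℝ) - 2 - a else 0) := by
    intro v
    by_cases hv : v = c
    · subst hv
      rw [if_pos (by linarith), if_pos rfl]
      linarith
    · rw [if_neg hv]
      split_ifs with h
      · linarith [hlt v hv]
      · linarith
  have hs := Finset.sum_le_sum fun v (_ : v ∈ Finset.univ) => hbound v
  rw [← averageDegree_mul_card, ← ha] at hs
  simp only [Finset.sum_add_distrib, Finset.sum_ite_eq', Finset.mem_univ, if_true,
    Finset.sum_const, Finset.card_univ, nsmul_eq_mul, Finset.sum_boole] at hs
  have : (4 : ℝ) < (Finset.univ.filter fun v => a ≤ G.degree v + 1).card := by nlinarith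
  exact_mod_cast this

end LargeDegrees

/-! ### Spiders have two large eigenvalues -/

section Spider

variable {V : Type*} {G : SimpleGraph V} {K S R : Set V}

namespace IsSpiderPartition

theorem notMem_head_of_mem_right (h : G.IsSpiderPartition K S R) {v : V} (hv : v ∈ S) : v ∉ R := by
  intro hr
  obtain ⟨k, hk, hvk⟩ := h.exists_not_adj v hv
  exact hvk (h.adj_of_mem k hk v hr).symm

theorem exists_forall_adj (h : G.IsSpiderPartition K S R) {x : V} (hx : x ∈ K) :
    ∃ x', ∀ z ∈ K, z ≠ x → z ≠ x' → G.Adj x z := by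
  by_cases hex : ∃ x' ∈ K, x ≠ x' ∧ ¬ G.Adj x x'
  · obtain ⟨x', hx', hne, hadj⟩ := hex
    refine ⟨x', fun z hz hzx hzx' => ?_⟩
    by_contra hxz
    exact hzx' (h.unique_left x hx x' hx' z hz hne hzx.symm hadj hxz).symm
  · push Not at hex
    exact ⟨x, fun z hz hzx _ => hex z hz hzx.symm⟩

variable [Fintype V] [DecidableEq V] [DecidableRel G.Adj]

theorem degree_le_of_mem_right (h : G.IsSpiderPartition K S R) {s i : V} (hs : s ∈ S)
    (hi : i ∈ K) (hsi : G.Adj s i) : G.degree s ≤ G.degree i := by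
  obtain ⟨j, hj, hsj⟩ := h.exists_not_adj s hs
  have hij : i ≠ j := fun e => hsj (e ▸ hsi)
  have hadj : G.Adj i j := by
    by_contra hn
    exact hsj ((h.twin_left i hi j hj hij hn s).1 hsi)
  obtain ⟨i', hi'⟩ := h.exists_forall_adj hi
  refine degree_le_degree_of_swap (i' := i') (p := s) (q := j) ?_ hsi.symm hadj
    (fun e => h.disjoint j hj (e ▸ hs)) (G.loopless.irrefl _) hsj
  intro v hv h1 h2
  rcases h.cover v with hvK | hvS | hvR
  · exact hi' v hvK h1 h2
  · exact (h.twin_right s hs v hvS hv i hsi.ne.symm h1.symm).1 hsi.symm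
  · exact absurd hv (h.not_adj_of_mem s hs v hvR)

theorem degree_le_of_mem_head (h : G.IsSpiderPartition K S R) {r i : V} (hr : r ∈ R)
    (hi : i ∈ K) : G.degree r ≤ G.degree i := by
  obtain ⟨s, hs, his⟩ := h.exists_adj i hi
  obtain ⟨i', hi'⟩ := h.exists_forall_adj hi
  refine degree_le_degree_of_swap (i' := i') (p := r) (q := s) ?_ (h.adj_of_mem i hi r hr) his
    (fun e => h.notMem_head_of_mem_right hs (e ▸ hr)) (G.loopless.irrefl _)
    (fun h' => h.not_adj_of_mem s hs r hr h'.symm)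
  intro v hv h1 h2
  rcases h.cover v with hvK | hvS | hvR
  · exact hi' v hvK h1 h2
  · exact absurd hv.symm (h.not_adj_of_mem v hvS r hr)
  · exact h.adj_of_mem i hi v hvR

variable {a : ℝ}

/-- A leg `w` of large degree has exactly two neighbours, twins `i` and `i'` in `K`, whose only
other neighbour is a third vertex `j` of `K`. -/
theorem exists_neighbors_of_mem_right (h : G.IsSpiderPartition K S R) (h2 : 2 < a)
    (hn : ¬ G.HasTwoAbove a) {w : V} (hw : w ∈ S) (hwa : a ≤ G.degree w + 1) :
    ∃ i ∈ K, ∃ i' ∈ K, ∃ j ∈ K, i ≠ i' ∧ ¬ G.Adj i i' ∧ (∀ v, G.Adj w v ↔ v = i ∨ v = i') ∧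
      ∀ v, G.Adj i v ↔ v = w ∨ v = j := by
  have hdw : 1 < G.degree w := by
    have : (1 : ℝ) < G.degree w := by linarith
    exact_mod_cast this
  have htri : ∀ x y, G.Adj w x → G.Adj w y → G.degree w ≤ G.degree x →
      G.degree w ≤ G.degree y → ¬ G.Adj x y := fun x y hx hy hdx hdy hxy => by
    have hx' : (G.degree w : ℝ) ≤ G.degree x := by exact_mod_cast hdx
    have hy' : (G.degree w : ℝ) ≤ G.degree y := by exact_mod_cast hdy
    exact hn (hasTwoAbove_of_triangle hx hy hxy hwa (by linarith) (by linarith))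
  have hNK : ∀ v, G.Adj w v → v ∈ K := by
    intro v hv
    rcases h.cover v with hvK | hvS | hvR
    · exact hvK
    · exfalso
      rw [← card_neighborFinset_eq_degree] at hdw
      obtain ⟨u, hu, huv⟩ := Finset.exists_mem_ne hdw v
      rw [mem_neighborFinset] at hu
      rcases h.cover u with huK | huS | huR
      · have htw := h.twin_right w hw v hvS hv
        have hdv : G.degree w ≤ G.degree v := by
          have hsub : (G.neighborFinset w).erase v ⊆ (G.neighborFinset v).erase w := by
            intro z hz
            rw [Finset.mem_erase, mem_neighborFinset] at hz ⊢
            exact ⟨hz.2.ne.symm, ((htw z hz.2.ne.symm hz.1).1 hz.2.symm).symm⟩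
          have := Finset.card_le_card hsub
          rw [Finset.card_erase_of_mem (by simpa), Finset.card_erase_of_mem (by simpa using hv.symm),
            card_neighborFinset_eq_degree, card_neighborFinset_eq_degree] at this
          have := (G.degree_pos_iff_exists_adj v).2 ⟨w, hv.symm⟩
          omega
        exact htri u v hu hv (h.degree_le_of_mem_right hw huK hu) hdv
          ((htw u hu.ne.symm huv).1 hu.symm)
      · exact huv (h.unique_right w hw u huS v hvS hu hv)
      · exact h.not_adj_of_mem w hw u huR hu
    · exact absurd hv (h.not_adj_of_mem w hw v hvR)
  -- no two neighbours of `w` are adjacent, so they form a pair of twins and `a ≤ 3`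
  have hind : ∀ x y, G.Adj w x → G.Adj w y → ¬ G.Adj x y := fun x y hx hy =>
    htri x y hx hy (h.degree_le_of_mem_right hw (hNK x hx) hx)
      (h.degree_le_of_mem_right hw (hNK y hy) hy)
  have hdw' := hdw
  rw [← card_neighborFinset_eq_degree, Finset.one_lt_card] at hdw'
  obtain ⟨i, hi, i', hi', hii'⟩ := hdw'
  rw [mem_neighborFinset] at hi hi'
  have hiK := hNK i hi
  have hiK' := hNK i' hi'
  have hN : ∀ v, G.Adj w v ↔ v = i ∨ v = i' := by
    refine fun v => ⟨fun hv => ?_, ?_⟩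
    · by_contra! hne
      exact hne.2 (h.unique_left i hiK i' hiK' v (hNK v hv) hii' hne.1.symm (hind i i' hi hi')
        (hind i v hi hv)).symm
    · rintro (rfl | rfl) <;> assumption
  have hdw2 : G.degree w ≤ 2 := by
    have : G.neighborFinset w ⊆ {i, i'} := fun v hv => by
      rw [mem_neighborFinset, hN] at hv
      simpa using hv
    exact card_neighborFinset_eq_degree G w ▸ (Finset.card_le_card this).trans Finset.card_le_two
  have htw := h.twin_left i hiK i' hiK' hii' (hind i i' hi hi')
  -- otherwise the twins `i` and `i'` are two vertices of degree at least `3 ≥ a`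
  have hdi : G.degree i ≤ 2 := by
    by_contra! h3
    have e : G.degree i = G.degree i' := by
      rw [← card_neighborFinset_eq_degree, ← card_neighborFinset_eq_degree]
      congr 1
      ext z
      rw [mem_neighborFinset, mem_neighborFinset, G.adj_comm, htw, G.adj_comm]
    have h3' : (3 : ℝ) ≤ G.degree i := by exact_mod_cast h3
    have hdw3 : (G.degree w : ℝ) ≤ 2 := by exact_mod_cast hdw2
    exact hn (hasTwoAbove_of_degree hii' h2 (by linarith) (by rw [← e]; linarith))
  obtain ⟨j, hj, hwj⟩ := h.exists_not_adj w hw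
  have hij : G.Adj i j := by
    by_contra hcon
    have hne : i ≠ j := fun e => hwj (e ▸ hi)
    exact hwj ((h.twin_left i hiK j hj hne hcon w).1 hi)
  refine ⟨i, hiK, i', hiK', j, hj, hii', hind i i' hi hi', hN, fun v => ⟨fun hv => ?_, ?_⟩⟩
  · by_contra! hne
    have hsub : ({v, w, j} : Finset V) ⊆ G.neighborFinset i := by
      intro z hz
      simp only [Finset.mem_insert, Finset.mem_singleton] at hz
      rw [mem_neighborFinset]
      rcases hz with rfl | rfl | rfl
      exacts [hv, hi.symm, hij]
    have := Finset.card_le_card hsub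
    rw [Finset.card_eq_three.2 ⟨v, w, j, hne.1, hne.2, fun e => h.disjoint j hj (e ▸ hw), rfl⟩,
      card_neighborFinset_eq_degree] at this
    omega
  · rintro (rfl | rfl)
    exacts [hi.symm, hij]

/-- A leg of large degree leaves room for at most four vertices of large degree. -/
theorem card_le_four_of_mem_right (h : G.IsSpiderPartition K S R) (h2 : 2 < a)
    (hn : ¬ G.HasTwoAbove a) {w : V} (hw : w ∈ S) (hwa : a ≤ G.degree w + 1) :
    (Finset.univ.filter fun v => a ≤ G.degree v + 1).card ≤ 4 := by
  obtain ⟨i, hi, i', hi', j, hj, hii', hadj, -, hNi⟩ := h.exists_neighbors_of_mem_right h2 hn hw hwa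
  have htw := h.twin_left i hi i' hi' hii' hadj
  -- the body consists of `i`, `i'` and `j`
  have hK : ∀ b ∈ K, b = i ∨ b = i' ∨ b = j := by
    intro b hb
    by_cases hbi : b = i
    · exact Or.inl hbi
    by_cases hib : G.Adj i b
    · rcases (hNi b).1 hib with e | e
      · exact absurd (e ▸ hw) (h.disjoint b hb)
      · exact Or.inr (Or.inr e)
    · exact Or.inr (Or.inl (h.unique_left i hi i' hi' b hb hii' (Ne.symm hbi) hadj hib).symm)
  have hij : G.Adj i j := (hNi j).2 (Or.inr rfl)
  have hi'j : G.Adj i' j := ((htw j).1 hij.symm).symm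
  have hN : ∀ b, G.Adj b i ∨ G.Adj b i' → b = w ∨ b = j := by
    rintro b (hb | hb)
    exacts [(hNi b).1 hb.symm, (hNi b).1 ((htw b).2 hb).symm]
  have hsub : (Finset.univ.filter fun v => a ≤ G.degree v + 1) ⊆ {w, i, i', j} := by
    intro b hb
    have hba := (Finset.mem_filter.1 hb).2
    simp only [Finset.mem_insert, Finset.mem_singleton]
    rcases h.cover b with hbK | hbS | hbR
    · exact Or.inr (hK b hbK)
    · obtain ⟨l, hl, l', hl', -, -, hll', hladj, hNb, -⟩ :=
        h.exists_neighbors_of_mem_right h2 hn hbS hba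
      have hbl := (hNb l).2 (Or.inl rfl)
      have hbl' := (hNb l').2 (Or.inr rfl)
      have : G.Adj b i ∨ G.Adj b i' := by
        rcases hK l hl with rfl | rfl | rfl
        · exact Or.inl hbl
        · exact Or.inr hbl
        · rcases hK l' hl' with rfl | rfl | rfl
          · exact Or.inl hbl'
          · exact Or.inr hbl'
          · exact absurd rfl hll'
      rcases hN b this with e | e
      · exact Or.inl e
      · exact Or.inr (Or.inr (Or.inr e))
    · rcases hN b (Or.inl (h.adj_of_mem i hi b hbR).symm) with e | e
      · exact Or.inl e
      · exact Or.inr (Or.inr (Or.inr e))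
  exact (Finset.card_le_card hsub).trans Finset.card_le_four

/-- Of five vertices of large degree, some three form a triangle unless a leg is among them. -/
theorem hasTwoAbove_averageDegree (h : G.IsSpiderPartition K S R)
    (hG : ∀ v, ∃ u, u ≠ v ∧ ¬ G.Adj v u) : G.HasTwoAbove G.averageDegree := by
  by_contra hn
  obtain ⟨s, i, j, t, hi, hj, hp⟩ := h.exists_path
  have : Nonempty V := ⟨s⟩
  have h2 : 2 < G.averageDegree := by
    by_contra! hle
    exact hn ((hasTwoAbove_two_of_path hp.1 hp.2.1 hp.2.2.1 hp.2.2.2.1 hp.2.2.2.2.1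
      hp.2.2.2.2.2).mono hle)
  have hcard := four_lt_card_of_not_hasTwoAbove h2 hn hG
  set B := Finset.univ.filter fun v => G.averageDegree ≤ G.degree v + 1 with hB
  have hmem : ∀ v, v ∈ B ↔ G.averageDegree ≤ G.degree v + 1 := fun v => by simp [hB]
  have hBK : ∀ v ∈ B, v ∈ K := by
    intro v hv
    rw [hmem] at hv
    rcases h.cover v with hvK | hvS | hvR
    · exact hvK
    · exact absurd (h.card_le_four_of_mem_right h2 hn hvS hv) (not_le.2 hcard)
    · exfalso
      have key : ∀ k ∈ K, G.averageDegree ≤ G.degree k + 1 := fun k hk => by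
        have : (G.degree v : ℝ) ≤ G.degree k := by
          exact_mod_cast h.degree_le_of_mem_head hvR hk
        linarith
      exact hn (hasTwoAbove_of_triangle hp.2.1 (h.adj_of_mem i hi v hvR)
        (h.adj_of_mem j hj v hvR) (key i hi) (key j hj) hv)
  obtain ⟨x, hx⟩ := Finset.card_pos.1 (by omega : 0 < B.card)
  obtain ⟨x', hx'⟩ := h.exists_forall_adj (hBK x hx)
  obtain ⟨y, hy, hy'⟩ := Finset.exists_mem_notMem_of_card_lt_card
    (lt_of_le_of_lt (Finset.card_le_two (a := x) (b := x')) (by omega : 2 < B.card))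
  obtain ⟨y', hyy'⟩ := h.exists_forall_adj (hBK y hy)
  obtain ⟨z, hz, hz'⟩ := Finset.exists_mem_notMem_of_card_lt_card
    (lt_of_le_of_lt (Finset.card_le_four (a := x) (b := x') (c := y) (d := y')) hcard)
  simp only [Finset.mem_insert, Finset.mem_singleton, not_or] at hy' hz'
  exact hn (hasTwoAbove_of_triangle (hx' y (hBK y hy) hy'.1 hy'.2)
    (hx' z (hBK z hz) hz'.1 hz'.2.1) (hyy' z (hBK z hz) hz'.2.2.1 hz'.2.2.2)
    ((hmem x).1 hx) ((hmem y).1 hy) ((hmem z).1 hz))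

end IsSpiderPartition

end Spider

/-! ### Graphs on five vertices -/

section FiveVertexDegrees

variable {V : Type*} [Fintype V] [DecidableEq V] {G : SimpleGraph V} [DecidableRel G.Adj]

omit [DecidableEq V] in
theorem degree_eq_of_table {A : Fin 5 → Fin 5 → Bool} {f : Fin 5 → V}
    (hf : Function.Bijective f) (hA : ∀ i j, G.Adj (f i) (f j) ↔ A i j = true) (i : Fin 5) :
    G.degree (f i) = (Finset.univ.filter fun j => A i j = true).card := by
  rw [← card_neighborFinset_eq_degree, ← Finset.card_map (⟨f, hf.1⟩ : Fin 5 ↪ V)]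
  congr 1
  ext v
  obtain ⟨j, rfl⟩ := hf.2 v
  simp [hA]

omit [DecidableEq V] in
theorem averageDegree_eq_of_table {A : Fin 5 → Fin 5 → Bool} {f : Fin 5 → V}
    (hf : Function.Bijective f) (hA : ∀ i j, G.Adj (f i) (f j) ↔ A i j = true) :
    G.averageDegree =
      ((∑ i, (Finset.univ.filter fun j => A i j = true).card : ℕ) : ℝ) / 5 := by
  have h1 := G.averageDegree_mul_card
  have h2 : Fintype.card V = 5 := by
    rw [← Fintype.card_of_bijective hf, Fintype.card_fin]
  have h3 : ∑ i, (G.degree (f i) : ℝ) = ∑ v, (G.degree v : ℝ) :=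
    (Equiv.ofBijective f hf).sum_comp fun v => (G.degree v : ℝ)
  rw [h2, ← h3] at h1
  simp only [degree_eq_of_table hf hA] at h1
  rw [Nat.cast_sum, ← h1]
  simp

theorem hasTwoAbove_averageDegree_of_table {A : Fin 5 → Fin 5 → Bool}
    (hA : A = houseTable ∨ A = coHouseTable ∨ A = c5Table) {f : Fin 5 → V}
    (hf : Function.Bijective f) (hfA : ∀ i j, G.Adj (f i) (f j) ↔ A i j = true) :
    G.HasTwoAbove G.averageDegree := by
  have havg := averageDegree_eq_of_table hf hfA
  have hdeg := degree_eq_of_table hf hfA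
  rcases hA with rfl | rfl | rfl
  · have e : ∑ i, (Finset.univ.filter fun j => houseTable i j = true).card = 12 := by decide
    have e0 : (Finset.univ.filter fun j => houseTable 0 j = true).card = 3 := by decide
    have e3 : (Finset.univ.filter fun j => houseTable 3 j = true).card = 3 := by decide
    rw [e] at havg
    have h0 := hdeg 0
    have h3 := hdeg 3
    rw [e0] at h0
    rw [e3] at h3
    refine hasTwoAbove_of_degree (hf.1.ne (by decide : (0 : Fin 5) ≠ 3)) ?_ ?_ ?_ <;>
      simp only [havg, h0, h3] <;> norm_num
  · have e : ∑ i, (Finset.univ.filter fun j => coHouseTable i j = true).card = 8 := by decide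
    rw [e] at havg
    refine HasTwoAbove.mono (hasTwoAbove_two_of_path (p := f 0) (q := f 2) (r := f 4) (s := f 1)
      ?_ ?_ ?_ ?_ ?_ ?_) (by rw [havg]; norm_num) <;> rw [hfA] <;> decide
  · have e : ∑ i, (Finset.univ.filter fun j => c5Table i j = true).card = 10 := by decide
    rw [e] at havg
    refine HasTwoAbove.mono (hasTwoAbove_two_of_path (p := f 0) (q := f 1) (r := f 2) (s := f 3)
      ?_ ?_ ?_ ?_ ?_ ?_) (by rw [havg]; norm_num) <;> rw [hfA] <;> decide

theorem IsLaden.hasTwoAbove_of_cutConnected [Nontrivial V] (hl : G.IsLaden)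
    (hG : G.CutConnected) (hG' : Gᶜ.CutConnected) : G.HasTwoAbove G.averageDegree := by
  rcases hl.exists_spiderPartition_or hG hG' with ⟨K, S, R, h⟩ | ⟨A, hA, f, hf, hfA⟩
  · refine h.hasTwoAbove_averageDegree fun v => ?_
    obtain ⟨u, hu⟩ := exists_ne v
    obtain ⟨x, rfl, y, hy, hxy⟩ := hG' {v} ⟨v, rfl⟩ ⟨u, hu⟩
    exact ⟨y, hy, (compl_adj _ _ _ |>.1 hxy).2⟩
  · exact hasTwoAbove_averageDegree_of_table hA hf hfA

end FiveVertexDegrees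

/-! ### Reduction to star-like graphs -/

section Induction

universe u

/-- Induction on the number of vertices: a disconnected graph reduces to a part, a graph with
disconnected complement is a join, and the remaining graphs are spiders or have five vertices. -/
theorem IsLaden.starLike_or_hasTwoAbove (n : ℕ) :
    ∀ (V : Type u) [Fintype V] [DecidableEq V] [Nonempty V] (G : SimpleGraph V)
      [DecidableRel G.Adj], G.IsLaden → Fintype.card V = n →
      G.IsStarLike ∨ G.HasTwoAbove G.averageDegree := by
  induction n using Nat.strong_induction_on with
  | _ n ih =>
    intro V _ _ _ G _ hl hn
    classical
    by_cases hG : G.CutConnected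
    · by_cases hG' : Gᶜ.CutConnected
      · rcases subsingleton_or_nontrivial V with hV | hV
        · exact Or.inl ⟨Classical.arbitrary V, fun u v _ => Or.inl (Subsingleton.elim _ _)⟩
        · exact Or.inr (hl.hasTwoAbove_of_cutConnected hG hG')
      · simp only [CutConnected, not_forall, exists_prop, not_exists, not_and, compl_adj] at hG'
        obtain ⟨X, hne, hc, hX⟩ := hG'
        refine starLike_or_hasTwoAbove_of_join (X := X.toFinset) (fun x hx y hy => ?_) ?_ ?_
        · rw [Set.mem_toFinset] at hx hy
          by_contra h
          exact hX x hx y hy (fun e => hy (e ▸ hx)) h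
        · simpa using hne
        · simpa [← Set.toFinset_compl] using hc
    · simp only [CutConnected, not_forall, exists_prop, not_exists, not_and] at hG
      obtain ⟨X, hne, hc, hX⟩ := hG
      have hpart : ∀ Y : Set V, Y.Nonempty → Yᶜ.Nonempty → (∀ x ∈ Y, ∀ y ∉ Y, ¬ G.Adj x y) →
          G.averageDegree ≤ (G.induce Y).averageDegree →
          G.IsStarLike ∨ G.HasTwoAbove G.averageDegree := by
        intro Y hY hYc hYX havg
        have : Nonempty Y := hY.to_subtype
        have hlt : Fintype.card Y < n := by
          obtain ⟨y, hy⟩ := hYc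
          rw [← hn]
          exact Fintype.card_subtype_lt hy
        exact starLike_or_hasTwoAbove_of_part hY hYX havg
          (ih _ hlt Y (G.induce Y) (hl.of_embedding (Embedding.induce Y)) rfl)
      rcases averageDegree_le_induce_or hne hX with h | h
      · exact hpart X hne hc hX h
      · refine hpart Xᶜ hc (by simpa using hne)
          (fun x hx y hy hxy => hX y (not_not.1 hy) x hx hxy.symm) (h.trans (le_of_eq ?_))
        congr!

end Induction

/-! ### Stars with isolated vertices -/

section Stars

variable {V : Type*} {G : SimpleGraph V} {c : V}

theorem adj_iff_of_forall_eq_or (hc : ∀ u v, G.Adj u v → u = c ∨ v = c) (u v : V) :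
    G.Adj u v ↔ u = c ∧ G.Adj c v ∨ v = c ∧ G.Adj c u := by
  constructor
  · intro h
    rcases hc u v h with rfl | rfl
    exacts [Or.inl ⟨rfl, h⟩, Or.inr ⟨rfl, h.symm⟩]
  · rintro (⟨rfl, h⟩ | ⟨rfl, h⟩)
    exacts [h, h.symm]

/-- A star plus isolated vertices is determined by its numbers of vertices and of leaves. -/
theorem nonempty_iso_of_forall_eq_or [Finite V] {W : Type*} [Finite W] {H : SimpleGraph W} {d : W}
    (hc : ∀ u v, G.Adj u v → u = c ∨ v = c) (hd : ∀ u v, H.Adj u v → u = d ∨ v = d)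
    (hdeg : (G.neighborSet c).ncard = (H.neighborSet d).ncard)
    (hcard : Nat.card V = Nat.card W) : Nonempty (G ≃g H) := by
  classical
  have hG := Set.ncard_add_ncard_compl (G.neighborSet c)
  have hH := Set.ncard_add_ncard_compl (H.neighborSet d)
  obtain ⟨e1⟩ : Nonempty (G.neighborSet c ≃ H.neighborSet d) := by
    rw [← Finite.card_eq, Nat.card_coe_set_eq, Nat.card_coe_set_eq, hdeg]
  obtain ⟨e2⟩ : Nonempty (((G.neighborSet c)ᶜ : Set V) ≃ ((H.neighborSet d)ᶜ : Set W)) := by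
    rw [← Finite.card_eq, Nat.card_coe_set_eq, Nat.card_coe_set_eq]
    omega
  set e : V ≃ W := (Equiv.Set.sumCompl _).symm.trans
    ((Equiv.sumCongr e1 e2).trans (Equiv.Set.sumCompl _)) with he
  have hadj : ∀ v, H.Adj d (e v) ↔ G.Adj c v := by
    intro v
    by_cases hv : v ∈ G.neighborSet c
    · have : e v = e1 ⟨v, hv⟩ := by simp [he, Equiv.Set.sumCompl_symm_apply_of_mem hv]
      rw [this]
      exact iff_of_true (e1 ⟨v, hv⟩).2 hv
    · have : e v = e2 ⟨v, hv⟩ := by simp [he, Equiv.Set.sumCompl_symm_apply_of_notMem hv]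
      rw [this]
      exact iff_of_false (e2 ⟨v, hv⟩).2 hv
  -- `e` maps leaves to leaves; a transposition makes it respect the centres as well
  have hswap : ∀ v, H.Adj d (Equiv.swap (e c) d (e v)) ↔ G.Adj c v := by
    intro v
    rw [← hadj]
    by_cases h1 : e v = e c
    · rw [h1, Equiv.swap_apply_left, hadj]
      simp
    by_cases h2 : e v = d
    · rw [h2, Equiv.swap_apply_right, hadj]
      simp
    · rw [Equiv.swap_apply_of_ne_of_ne h1 h2]
  have hcd : ∀ v, Equiv.swap (e c) d (e v) = d ↔ v = c := by
    intro v
    rw [← (e.trans (Equiv.swap (e c) d)).apply_eq_iff_eq (x := v) (y := c)]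
    simp
  refine ⟨⟨e.trans (Equiv.swap (e c) d), fun {u v} => ?_⟩⟩
  rw [adj_iff_of_forall_eq_or hd, adj_iff_of_forall_eq_or hc]
  simp only [Equiv.trans_apply, hswap, hcd]

variable [Fintype V] [DecidableEq V] [DecidableRel G.Adj]

theorem averageDegree_mul_card_of_star (hc : ∀ u v, G.Adj u v → u = c ∨ v = c) :
    G.averageDegree * Fintype.card V = 2 * G.degree c := by
  have hdeg : ∀ v, (G.degree v : ℝ) =
      (if G.Adj c v then 1 else 0) + if v = c then (G.degree c : ℝ) else 0 := by
    intro v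
    by_cases hv : v = c
    · subst hv
      simp
    · have : G.neighborFinset v = if G.Adj c v then {c} else ∅ := by
        ext w
        rw [mem_neighborFinset, adj_iff_of_forall_eq_or hc]
        split_ifs with h <;> simp [hv, h]
      rw [← card_neighborFinset_eq_degree, this, if_neg hv]
      split_ifs <;> simp
  have hs : ∑ v, (if G.Adj c v then (1 : ℝ) else 0) = G.degree c := by
    rw [Finset.sum_boole, ← card_neighborFinset_eq_degree, neighborFinset_eq_filter]
  rw [averageDegree_mul_card, Finset.sum_congr rfl fun v _ => hdeg v, Finset.sum_add_distrib, hs]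
  simp
  ring

theorem lapForm_self_of_star (hc : ∀ u v, G.Adj u v → u = c ∨ v = c) (z : V → ℝ) :
    G.lapForm z z = ∑ v, if G.Adj c v then (z c - z v) ^ 2 else 0 := by
  set S := ∑ v, if G.Adj c v then (z c - z v) ^ 2 else 0 with hS
  have key : ∀ u, (∑ v, if G.Adj u v then (z u - z v) ^ 2 else 0) =
      (if G.Adj c u then (z c - z u) ^ 2 else 0) + if u = c then S else 0 := by
    intro u
    by_cases hu : u = c
    · subst hu
      simp [hS]
    · rw [if_neg hu, add_zero, Finset.sum_eq_single c]
      · simp only [G.adj_comm u c, sub_sq_comm (z u)]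
      · intro v _ hv
        rw [if_neg]
        intro h
        exact (hc u v h).elim hu hv
      · simp
  rw [lapForm_self, Finset.sum_congr rfl fun u _ => key u, Finset.sum_add_distrib, ← hS]
  simp

/-- For a star with `r` leaves on `n` vertices in all, the condition `n < 2 * r` says that the
average degree exceeds `1`. -/
theorem not_hasTwoAbove_averageDegree_iff_of_star (hc : ∀ u v, G.Adj u v → u = c ∨ v = c) :
    ¬ G.HasTwoAbove G.averageDegree ↔ Fintype.card V = 1 ∨ G.degree c = 1 ∨
      2 ≤ G.degree c ∧ Fintype.card V < 2 * G.degree c := by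
  have : Nonempty V := ⟨c⟩
  have havg := averageDegree_mul_card_of_star hc
  have hpos : (0 : ℝ) < Fintype.card V := by exact_mod_cast Fintype.card_pos
  constructor
  · intro hn
    by_contra! hcon
    obtain ⟨h1, h2, h3⟩ := hcon
    rcases Nat.lt_or_ge (G.degree c) 2 with h | h
    · have h0 : G.degree c = 0 := by omega
      have hadj : ∀ v, ¬ G.Adj c v := fun v hv => by
        have := (G.degree_pos_iff_exists_adj c).2 ⟨v, hv⟩
        omega
      have ha : G.averageDegree = 0 := by
        rw [h0] at havg
        simpa [hpos.ne'] using havg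
      have : 1 < Fintype.card V := by
        have := Fintype.card_pos (α := V)
        omega
      obtain ⟨u, v, huv⟩ := Fintype.exists_pair_of_one_lt_card this
      refine hn (hasTwoAbove_of_not_adj huv (fun h => ?_) ?_ ?_)
      · rw [adj_iff_of_forall_eq_or hc] at h
        exact h.elim (fun h => hadj _ h.2) fun h => hadj _ h.2
      all_goals rw [ha]; positivity
    · have h3' : (2 : ℝ) * G.degree c ≤ Fintype.card V := by exact_mod_cast h3 h
      have ha : G.averageDegree ≤ 1 := by
        by_contra! hlt
        nlinarith
      rw [← card_neighborFinset_eq_degree] at h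
      obtain ⟨u, hu, v, hv, huv⟩ := Finset.one_lt_card.1 h
      rw [mem_neighborFinset] at hu hv
      have h1 : ∀ {w}, G.Adj c w → G.averageDegree ≤ G.degree w := fun {w} hw =>
        ha.trans (by exact_mod_cast (G.degree_pos_iff_exists_adj w).2 ⟨c, hw.symm⟩)
      exact hn (hasTwoAbove_of_not_adj huv
        (fun h => (hc u v h).elim hu.ne.symm hv.ne.symm) (h1 hu) (h1 hv))
  · intro h hT
    have hsq : ∀ z : V → ℝ, z ⬝ᵥ z = ∑ v, z v ^ 2 := fun z => by
      simp [dotProduct, sq]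
    rcases h with h | h | ⟨h2, h⟩
    · obtain ⟨z, hz0, hz, -⟩ := hT.exists_ker (LinearMap.proj c)
      refine hz0 (funext fun v => ?_)
      rw [Fintype.card_le_one_iff.1 h.le v c]
      exact hz
    · obtain ⟨u, hu⟩ := (G.degree_pos_iff_exists_adj c).1 (by omega : 0 < G.degree c)
      have huniq : ∀ v, G.Adj c v → v = u := fun v hv => by
        rw [← card_neighborFinset_eq_degree] at h
        exact Finset.card_le_one.1 h.le v (by simpa) u (by simpa)
      obtain ⟨z, hz0, hz, hle⟩ := hT.exists_ker
        (LinearMap.proj (R := ℝ) (φ := fun _ => ℝ) c - LinearMap.proj u)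
      have hz' : z c = z u := sub_eq_zero.1 hz
      have hform : G.lapForm z z = 0 := by
        rw [lapForm_self_of_star hc]
        refine Finset.sum_eq_zero fun v _ => ?_
        split_ifs with hv
        · rw [huniq v hv, hz', sub_self, sq, zero_mul]
        · rfl
      have hzz := dotProduct_self_pos' hz0
      have ha : 0 < G.averageDegree := by
        rw [h] at havg
        by_contra! hneg
        push_cast at havg
        nlinarith
      rw [hform] at hle
      nlinarith [mul_pos ha hzz]
    · obtain ⟨z, hz0, hz, hle⟩ := hT.exists_ker (LinearMap.proj c)
      have hz' : z c = 0 := hz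
      have hform : G.lapForm z z ≤ z ⬝ᵥ z := by
        rw [lapForm_self_of_star hc, hsq]
        refine Finset.sum_le_sum fun v _ => ?_
        split_ifs
        · rw [hz', zero_sub, neg_sq]
        · positivity
      have hzz := dotProduct_self_pos' hz0
      have ha : 1 < G.averageDegree := by
        have h' : (Fintype.card V : ℝ) < 2 * G.degree c := by exact_mod_cast h
        by_contra! hneg
        nlinarith
      nlinarith [mul_lt_mul_of_pos_right ha hzz]

omit [DecidableEq V] in
theorem nonempty_iso_starAddIsolated_iff {r s : ℕ} :
    Nonempty (G ≃g starAddIsolated r s) ↔ ∃ c, (∀ u v, G.Adj u v → u = c ∨ v = c) ∧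
      G.degree c = r ∧ Fintype.card V = r + s + 1 := by
  have hd : ∀ u v, (starAddIsolated r s).Adj u v → u = .inl (.inl 0) ∨ v = .inl (.inl 0) := by
    rintro ((u | u) | u) ((v | v) | v) <;> simp [starAddIsolated, Subsingleton.elim _ (0 : Fin 1)]
  have hdeg : ((starAddIsolated r s).neighborSet (.inl (.inl 0))).ncard = r := by
    have : (starAddIsolated r s).neighborSet (.inl (.inl 0)) =
        Set.range (Sum.inl ∘ Sum.inr) := by
      ext ((u | u) | u) <;> simp [starAddIsolated]
    rw [this, Set.ncard_range_of_injective (Sum.inl_injective.comp Sum.inr_injective),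
      Nat.card_fin]
  have hcard : Nat.card ((Fin 1 ⊕ Fin r) ⊕ Fin s) = r + s + 1 := by
    simp
    ring
  have hn : ∀ c, (G.neighborSet c).ncard = G.degree c := fun c => by
    rw [← Nat.card_coe_set_eq, Nat.card_eq_fintype_card, card_neighborSet_eq_degree]
  constructor
  · rintro ⟨e⟩
    refine ⟨e.symm (.inl (.inl 0)), fun u v h => ?_, ?_, ?_⟩
    · rw [RelIso.eq_symm_apply, RelIso.eq_symm_apply]
      exact hd _ _ (e.map_adj_iff.2 h)
    · refine (hn _).symm.trans (Eq.trans ?_ hdeg)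
      rw [← Set.ncard_image_of_injective _ e.injective]
      congr 1
      ext v
      obtain ⟨v, rfl⟩ := e.surjective v
      simp [← e.map_adj_iff]
    · rw [← Nat.card_eq_fintype_card, Nat.card_congr e.toEquiv, hcard]
  · rintro ⟨c, hc, h1, h2⟩
    exact nonempty_iso_of_forall_eq_or hc hd (by rw [hn, h1, hdeg])
      (by rw [hcard, Nat.card_eq_fintype_card, h2])

theorem nonempty_iso_K2AddIsolated (s : ℕ) :
    Nonempty (K2AddIsolated s ≃g starAddIsolated 1 s) := by
  classical
  refine nonempty_iso_starAddIsolated_iff.2 ⟨.inl 0, ?_, ?_, ?_⟩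
  · rintro (u | u) (v | v) <;> simp [K2AddIsolated]
    omega
  · rw [degree_eq_one_iff_existsUnique_adj]
    refine ⟨.inl 1, by simp [K2AddIsolated], ?_⟩
    rintro (v | v) <;> simp [K2AddIsolated]
    omega
  · simp
    ring

theorem nonempty_iso_completeGraph_one :
    Nonempty (completeGraph (Fin 1) ≃g starAddIsolated 0 0) := by
  classical
  refine nonempty_iso_starAddIsolated_iff.2 ⟨0, fun u v _ => Or.inl (Subsingleton.elim _ _), ?_, ?_⟩
  · simp
  · simp

end Stars

end SimpleGraph

theorem mainTheorem6 {V : Type*} [Fintype V] [DecidableEq V] (G : SimpleGraph V)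
    [DecidableRel G.Adj] (hG : G.IsExtendedP4Laden) :
    G.laplacianSigma = 1 ↔
      (Nonempty (G ≃g SimpleGraph.completeGraph (Fin 1)) ∨
        (∃ s : ℕ, Nonempty (G ≃g SimpleGraph.K2AddIsolated s)) ∨
        (∃ r s : ℕ, 2 ≤ r ∧ s < r - 1 ∧ Nonempty (G ≃g SimpleGraph.starAddIsolated r s))) := by
  have h0 : Nonempty (G ≃g SimpleGraph.completeGraph (Fin 1)) ↔
      Nonempty (G ≃g SimpleGraph.starAddIsolated 0 0) := by
    obtain ⟨e⟩ := SimpleGraph.nonempty_iso_completeGraph_one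
    exact ⟨fun ⟨f⟩ => ⟨f.trans e⟩, fun ⟨f⟩ => ⟨f.trans e.symm⟩⟩
  have h1 : ∀ s, Nonempty (G ≃g SimpleGraph.K2AddIsolated s) ↔
      Nonempty (G ≃g SimpleGraph.starAddIsolated 1 s) := fun s => by
    obtain ⟨e⟩ := SimpleGraph.nonempty_iso_K2AddIsolated s
    exact ⟨fun ⟨f⟩ => ⟨f.trans e⟩, fun ⟨f⟩ => ⟨f.trans e.symm⟩⟩
  simp only [h0, h1, SimpleGraph.nonempty_iso_starAddIsolated_iff]
  have h2 := SimpleGraph.two_le_laplacianSigma_iff G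
  constructor
  · intro h
    have hV : Nonempty V := by
      by_contra hV
      rw [not_nonempty_iff] at hV
      simp [SimpleGraph.laplacianSigma] at h
    have hn : ¬ G.HasTwoAbove G.averageDegree := fun hT => by
      have := h2.2 hT
      omega
    obtain ⟨c, hc⟩ :=
      (SimpleGraph.IsLaden.starLike_or_hasTwoAbove _ V G hG.isLaden rfl).resolve_right hn
    have hlt := G.degree_lt_card_verts c
    rcases (SimpleGraph.not_hasTwoAbove_averageDegree_iff_of_star hc).1 hn with h | h | ⟨h, h'⟩
    · exact Or.inl ⟨c, hc, by omega, by omega⟩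
    · exact Or.inr (Or.inl ⟨Fintype.card V - 2, c, hc, h, by omega⟩)
    · exact Or.inr (Or.inr ⟨G.degree c, Fintype.card V - G.degree c - 1, h, by omega, c, hc, rfl,
        by omega⟩)
  · intro h
    obtain ⟨c, hc, h⟩ : ∃ c, (∀ u v, G.Adj u v → u = c ∨ v = c) ∧ (Fintype.card V = 1 ∨
        G.degree c = 1 ∨ 2 ≤ G.degree c ∧ Fintype.card V < 2 * G.degree c) := by
      rcases h with ⟨c, hc, -, h⟩ | ⟨s, c, hc, h, -⟩ | ⟨r, s, hr, hs, c, hc, rfl, h⟩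
      · exact ⟨c, hc, Or.inl h⟩
      · exact ⟨c, hc, Or.inr (Or.inl h)⟩
      · exact ⟨c, hc, Or.inr (Or.inr ⟨hr, by omega⟩)⟩
    have : Nonempty V := ⟨c⟩
    have h3 := G.one_le_laplacianSigma
    have h4 := (SimpleGraph.not_hasTwoAbove_averageDegree_iff_of_star hc).2 h
    rw [← h2] at h4
    omega
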